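/- Consider the massively parallel computation (MPC) model. There are $p$ servers, and the input is initially partitioned among them in an arbitrary way such that every server stores at most a $1/p$ fraction (rounded up) of the input tuples. Computation proceeds in rounds. In each round every server sends to every server a bit string that depends on its identity, on its own initial fragment, on everything it has received in earlier rounds, and on random coins shared by all servers (e.g. randomly chosen hash functions). Local computation is unrestricted, and the algorithm knows $p$, the domain size $n$ and the relation size $m$, but nothing else about the input. After the last round every server emits a set of output tuples, and the algorithm computes a query if the union of these sets is the answer. The load is the maximum number of bits received by any server during any round. The triangle query is $$C_3(x_1,x_2,x_3) = S_1(x_1,x_2),\ S_2(x_2,x_3),\ S_3(x_3,x_1),$$ whose answer is the set of all $(a,b,c)$ with $(a,b)\in S_1$, $(b,c)\in S_2$, $(c,a)\in S_3$. **Theorem.** There is a randomized MPC algorithm with exactly $2$ rounds such that for every integer $c\ge 0$ there are constants $C$ and $k$, depending only on $c$, with the following property. Let $p\ge 1$, $n$ and $m$ be integers with $p^2\le m/p^{2/3}$. Let $S_1,S_2,S_3$ be any binary relations over a domain of $n$ elements that have exactly $m$ tuples each, so that all three have size $M = 2m\log_2 n$ bits, with no restriction on the distribution of the data. Let them be initially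 partitioned among the $p$ servers in any way as above. Then for every outcome of the coins the algorithm computes $C_3$, and with probability at least $1-p^{-c}$ its load is at most $$C\,(1+\ln p)^k\cdot \frac{M}{p^{2/3}},$$ that is, $\tilde O(M/p^{2/3})$, where $\tilde O$ hides a factor polylogarithmic in $p$. -/

import Mathlib

open Finset

/-! ### The Massively Parallel Computation (MPC) model -/

/-- What one server receives in one communication phase: a bit string from every server. -/
abbrev Inbox (p : ℕ) : Type := Fin p → List Bool

/-- A randomized MPC algorithm on `p` servers, each of which initially stores a fragment of type
`In` of the input and finally emits a finite set of elements of type `Out`.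

The servers share a uniformly random element of the finite set `Coins` (for instance, a tuple of
hash functions).  In each round, server `u` sends to every server `v` a bit string, which is
computed from the coins, the identity of `u`, the initial fragment of `u`, and everything that `u`
has received in the previous rounds (the list of its inboxes, oldest first, so that the length of
the list is the number of rounds completed).  After the last round every server computes its part
of the output.  Local computation is unrestricted. -/
structure MPCAlgorithm (p : ℕ) (In Out : Type) where
  Coins : Type
  [coinsFintype : Fintype Coins]
  [coinsNonempty : Nonempty Coins]
  rounds : ℕ
  send : Coins → (u : Fin p) → In → List (Inbox p) → (v : Fin p) → List Bool
  output : Coins → (u : Fin p) → In → List (Inbox p) → Finset Out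

attribute [instance] MPCAlgorithm.coinsFintype MPCAlgorithm.coinsNonempty

namespace MPCAlgorithm

variable {p : ℕ} {In Out : Type}

/-- The inboxes that server `v` has received during the first `t` rounds of the run with coins `ω`
on the initial fragments `x`. -/
def history (A : MPCAlgorithm p In Out) (ω : A.Coins) (x : Fin p → In) :
    ℕ → Fin p → List (Inbox p)
  | 0, _ => []
  | t + 1, v => history A ω x t v ++ [fun u => A.send ω u (x u) (history A ω x t u) v]

/-- The number of bits that server `v` receives during round `t` (counted from `0`). -/
def received (A : MPCAlgorithm p In Out) (ω : A.Coins) (x : Fin p → In) (t : ℕ) (v : Fin p) : ℕ :=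
  ∑ u : Fin p, (A.send ω u (x u) (A.history ω x t u) v).length

/-- The maximum load: the maximum number of bits received by any server during any round. -/
def load (A : MPCAlgorithm p In Out) (ω : A.Coins) (x : Fin p → In) : ℕ :=
  (range A.rounds).sup fun t => univ.sup fun v => A.received ω x t v

/-- The union of the outputs of all servers at the end of the run. -/
def result [DecidableEq Out] (A : MPCAlgorithm p In Out) (ω : A.Coins) (x : Fin p → In) :
    Finset Out :=
  univ.biUnion fun v => A.output ω v (x v) (A.history ω x A.rounds v)

end MPCAlgorithm

/-! ### The triangle query -/

/-- An instance of the three binary relations of the triangle query over the domain `Fin n`;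
also used for the part of such an instance that a single server stores. -/
abbrev TriangleInstance (n : ℕ) : Type := Fin 3 → Finset (Fin n × Fin n)

/-- The answer to the triangle query `C₃ = S₁(x₁, x₂), S₂(x₂, x₃), S₃(x₃, x₁)`, where
`S₁, S₂, S₃` are `I 0, I 1, I 2`. -/
def triangleQuery {n : ℕ} (I : TriangleInstance n) : Finset (Fin n × Fin n × Fin n) :=
  univ.filter fun t => (t.1, t.2.1) ∈ I 0 ∧ (t.2.1, t.2.2) ∈ I 1 ∧ (t.2.2, t.1) ∈ I 2

/-- The fragment of the instance stored at server `v`, where `owner j t` is the server that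
initially stores the tuple `t` of the `j`-th relation. -/
def fragment {n p : ℕ} (I : TriangleInstance n) (owner : Fin 3 → Fin n × Fin n → Fin p)
    (v : Fin p) : TriangleInstance n :=
  fun j => (I j).filter fun t => owner j t = v

/-- The instance is partitioned uniformly: no server stores more than a `1 / p` fraction (rounded
up to an integer) of all input tuples. -/
def IsUniformPartition {n p : ℕ} (I : TriangleInstance n)
    (owner : Fin 3 → Fin n × Fin n → Fin p) : Prop :=
  ∀ v, ∑ j, (fragment I owner v j).card ≤ ⌈((∑ j, (I j).card : ℕ) : ℝ) / p⌉₊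

/-- The size in bits, `2 m log₂ n`, of a binary relation with `m` tuples over a domain of `n`
elements. -/
noncomputable def bitSize (m n : ℕ) : ℝ := 2 * m * Real.logb 2 n

/-! Let `q` be about `p ^ (1/3)` and `U = m / q ^ 2`, which is of order `m / p ^ (2/3)`; the target
is that every server receives `O(τ ^ 2 * U)` tuples per round, with `τ` of order `1 + log p`.

Skewed values must be detected while data is already moving. In round one each server announces to
all others, in multiplicity, the values with local degree at least `t ≈ m / q ^ 5`. There are at
most `12 * q ^ 5 ≤ 12 * U` reports, because `q ^ 8 ≤ m`. A value with `θ = q ^ 4` reports on one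
side of one relation is heavy. Hence a variable has at most `12 * q` heavy values, a value that is
not heavy has degree `O(m / q)`, and an unreported value has degree `O(U)`. Simultaneously every
tuple goes to the hash of each endpoint that is locally below `t`, so all tuples at an unreported
value `y` meet at the hash of `y`.

In round two, triangles without heavy values are found by the HyperCube scheme on a `q × q × q`
grid. For a triangle with a heavy `x` and other values `y`, `z`, the tuples joining a heavy to a
reported value are broadcast; there are at most `144 * q ^ 6 ≤ 144 * U` per relation and side. If
`y` or `z` is reported, the broadcasts complete the triangle at a server that already has the
remaining tuples. If neither is, the hash of `y` knows the path `x y z` and sends it to the hash of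
the pair `(x, z)`, where `(z, x)` arrives as well. There are at most `12 * q * m` such paths, that
is `O(U)` per server on average, and each pair `(x, z)` carries only `O(U)` of them.

Correctness (`triangle_known`) holds for all coins. The loads follow from one Chernoff bound,
`rare_overload`, applied to one hash function at a time (`Rare.of_update`); the cube needs two
applications in succession (`rare_cell`). A union bound over `O(p)` events finishes the argument
(`rare_not_loadsBalanced`). -/

/-! ### Rare events for uniformly random functions -/

open Classical in
/-- The event `bad` has probability at most `ε` under the uniform distribution on `Ω`. -/
def Rare {Ω : Type*} [Fintype Ω] (ε : ℝ) (bad : Ω → Prop) : Prop :=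
  (#{ω | bad ω} : ℝ) ≤ ε * Fintype.card Ω

namespace Rare

variable {Ω : Type*} [Fintype Ω] {ε δ : ℝ} {bad bad' : Ω → Prop}

theorem mono (h : Rare ε bad) (hb : ∀ ω, bad' ω → bad ω) (hε : ε ≤ δ) : Rare δ bad' := by
  classical
  refine le_trans ?_ (h.trans (mul_le_mul_of_nonneg_right hε (Nat.cast_nonneg _)))
  exact_mod_cast card_le_card fun ω hω => by simp at hω ⊢; exact hb ω hω

theorem or (h : Rare ε bad) (h' : Rare δ bad') : Rare (ε + δ) fun ω => bad ω ∨ bad' ω := by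
  classical
  have := add_le_add h h'
  rw [← add_mul] at this
  refine le_trans ?_ this
  have := card_union_le (univ.filter bad) (univ.filter bad')
  rw [← filter_or] at this
  simp only
  exact_mod_cast this

theorem exists_mem {ι : Type*} {s : Finset ι} {bad : ι → Ω → Prop}
    (h : ∀ i ∈ s, Rare ε (bad i)) : Rare (#s * ε) fun ω => ∃ i ∈ s, bad i ω := by
  classical
  unfold Rare
  simp only
  calc (#{ω | ∃ i ∈ s, bad i ω} : ℝ) ≤ #(s.biUnion fun i => {ω | bad i ω}) := by
        refine Nat.cast_le.2 (card_le_card fun ω hω => ?_)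
        simpa using hω
    _ ≤ ∑ i ∈ s, (#{ω | bad i ω} : ℝ) := by exact_mod_cast card_biUnion_le
    _ ≤ ∑ i ∈ s, ε * Fintype.card Ω := sum_le_sum fun i hi => h i hi
    _ = #s * ε * Fintype.card Ω := by rw [sum_const, nsmul_eq_mul, mul_assoc]

theorem exists_index {ι : Type*} [Fintype ι] {bad : ι → Ω → Prop}
    (h : ∀ i, Rare ε (bad i)) : Rare (Fintype.card ι * ε) fun ω => ∃ i, bad i ω := by
  simpa using exists_mem (s := univ) fun i _ => h i

theorem le_card_compl (h : Rare ε bad) {good : Ω → Prop} (hg : ∀ ω, ¬ bad ω → good ω) :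
    (1 - ε) * Fintype.card Ω ≤ Nat.card {ω // good ω} := by
  classical
  have h1 : Fintype.card Ω ≤ #{ω | bad ω} + #{ω | good ω} := by
    rw [← card_univ]
    refine (card_le_card fun ω _ => ?_).trans (card_union_le _ _)
    by_cases hb : bad ω <;> simp [hb, hg]
  have h2 : (Fintype.card Ω : ℝ) ≤ #{ω | bad ω} + #{ω | good ω} := by exact_mod_cast h1
  rw [Nat.card_eq_fintype_card, Fintype.card_subtype]
  have := h
  unfold Rare at this
  linarith

/-- Resampling one coordinate of a uniformly random tuple leaves it uniformly random. -/
theorem of_update {ι B : Type*} [Fintype ι] [DecidableEq ι] [Fintype B]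
    {bad : (ι → B) → Prop} (j : ι)
    (h : ∀ ω, Rare ε fun b => bad (Function.update ω j b)) : Rare ε bad := by
  classical
  rcases isEmpty_or_nonempty B with hB | hB
  · have : IsEmpty (ι → B) := ⟨fun ω => hB.elim (ω j)⟩
    simp [Rare]
  -- Exchanging the `j`-th coordinate with the fresh sample is an involution, so it preserves the
  -- uniform distribution on pairs.
  let e : (ι → B) × B ≃ (ι → B) × B :=
    { toFun := fun q => (Function.update q.1 j q.2, q.1 j)
      invFun := fun q => (Function.update q.1 j q.2, q.1 j)
      left_inv := fun q => by simp
      right_inv := fun q => by simp }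
  have h1 : ∑ q : (ι → B) × B, (if bad (Function.update q.1 j q.2) then (1 : ℝ) else 0) =
      ∑ q : (ι → B) × B, if bad q.1 then (1 : ℝ) else 0 :=
    Fintype.sum_equiv e _ _ fun q => rfl
  rw [Fintype.sum_prod_type, Fintype.sum_prod_type] at h1
  have h3 : ∀ ω : ι → B, ∑ _b : B, (if bad ω then (1 : ℝ) else 0) =
      Fintype.card B * if bad ω then (1 : ℝ) else 0 := fun ω => by
    rw [sum_const, card_univ, nsmul_eq_mul]
  simp only [h3] at h1
  rw [← mul_sum, sum_boole] at h1
  simp only [sum_boole] at h1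
  have h2 : ∑ ω : ι → B, (#{b | bad (Function.update ω j b)} : ℝ) ≤
      ∑ _ω : ι → B, ε * Fintype.card B := sum_le_sum fun ω _ => h ω
  rw [h1] at h2
  simp only [sum_const, card_univ, nsmul_eq_mul] at h2
  have hpos : (0 : ℝ) < Fintype.card B := by exact_mod_cast Fintype.card_pos
  unfold Rare
  refine le_of_mul_le_mul_left (h2.trans_eq ?_) hpos
  ring

end Rare

/-- If the items of `S` are assigned to random places through their keys, no key is shared by more
than `W` items, and the expected number of items in `T` is at most `W`, then it is unlikely that
`T` gets more than `τ * W` items. -/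
theorem rare_overload {ι κ V : Type*} [Fintype κ] [DecidableEq κ] [Fintype V] [Nonempty V]
    [DecidableEq V] (S : Finset ι) (key : ι → κ) (T : Finset V) {W : ℝ} (τ : ℝ) (hW0 : 0 < W)
    (hW : ∀ k, (#{i ∈ S | key i = k} : ℝ) ≤ W) (hT : (#T : ℝ) * #S ≤ W * Fintype.card V) :
    Rare (Real.exp (2 - τ)) fun f : κ → V => τ * W < #{i ∈ S | f (key i) ∈ T} := by
  classical
  set N : ℝ := (Fintype.card V : ℝ) with hN
  have hN0 : 0 < N := by rw [hN]; exact_mod_cast Fintype.card_pos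
  -- Chernoff with weights `y k ∈ [0, 1]`: on this interval `exp y ≤ 1 + 2 * y`, so each key
  -- contributes a factor at most `exp (2 * #T / N * y k)` to the moment. The weights sum to `#S /
  -- W`, hence the exponential moment is at most `exp 2`, and Markov's inequality gives the tail.
  let y : κ → ℝ := fun k => #{i ∈ S | key i = k} / W
  have hy0 : ∀ k, 0 ≤ y k := fun k => by positivity
  have hy1 : ∀ k, y k ≤ 1 := fun k => (div_le_one hW0).2 (hW k)
  have hy : ∑ k, y k = #S / W := by
    rw [← sum_div]
    congr 1
    exact_mod_cast (card_eq_sum_card_fiberwise (f := key) (t := univ) (fun _ _ => by simp)).symm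
  have hload : ∀ f : κ → V, (#{i ∈ S | f (key i) ∈ T} : ℝ) / W =
      ∑ k, if f k ∈ T then y k else 0 := by
    intro f
    rw [div_eq_iff hW0.ne', sum_mul, card_eq_sum_card_fiberwise (f := key) (t := univ)
      (fun _ _ => by simp)]
    push_cast
    refine sum_congr rfl fun k _ => ?_
    rw [filter_filter]
    split_ifs with h
    · rw [div_mul_cancel₀ _ hW0.ne']
      congr 2
      ext i
      simp only [mem_filter]
      constructor
      · tauto
      · rintro ⟨h1, rfl⟩; tauto
    · rw [zero_mul, Nat.cast_eq_zero, card_eq_zero, filter_eq_empty_iff]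
      rintro i - ⟨h1, rfl⟩
      exact h h1
  have hfac : ∀ k, ∑ v : V, Real.exp (if v ∈ T then y k else 0) ≤
      N * Real.exp (2 * #T / N * y k) := by
    intro k
    have e1 : Real.exp (y k) ≤ 1 + 2 * y k := by
      have := Real.abs_exp_sub_one_sub_id_le (x := y k) (by rw [abs_of_nonneg (hy0 k)]; exact hy1 k)
      have := (abs_le.1 this).2
      nlinarith [hy0 k, hy1 k]
    calc ∑ v : V, Real.exp (if v ∈ T then y k else 0)
        ≤ ∑ v : V, (1 + if v ∈ T then 2 * y k else 0) := by
          refine sum_le_sum fun v _ => ?_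
          split_ifs
          · exact e1
          · simp
      _ = N * (2 * #T / N * y k + 1) := by
          rw [sum_add_distrib, sum_ite_mem]
          simp only [sum_const, card_univ, univ_inter, nsmul_eq_mul]
          field_simp
          ring
      _ ≤ _ := by
          gcongr
          exact Real.add_one_le_exp _
  have hmoment : ∑ f : κ → V, Real.exp (#{i ∈ S | f (key i) ∈ T} / W) ≤
      Fintype.card (κ → V) * Real.exp 2 := by
    calc ∑ f : κ → V, Real.exp (#{i ∈ S | f (key i) ∈ T} / W)
        = ∑ f : κ → V, ∏ k, Real.exp (if f k ∈ T then y k else 0) := by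
          refine sum_congr rfl fun f _ => ?_
          rw [hload, Real.exp_sum]
      _ = ∏ k, ∑ v : V, Real.exp (if v ∈ T then y k else 0) := by
          rw [prod_univ_sum, Fintype.piFinset_univ]
      _ ≤ ∏ k, (N * Real.exp (2 * #T / N * y k)) :=
          prod_le_prod (fun k _ => sum_nonneg fun _ _ => (Real.exp_pos _).le) fun k _ => hfac k
      _ = N ^ Fintype.card κ * Real.exp (2 * #T / N * (#S / W)) := by
          rw [prod_mul_distrib, ← Real.exp_sum, ← mul_sum, hy]
          simp
      _ ≤ _ := by
          rw [Fintype.card_fun]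
          push_cast
          gcongr
          rw [div_mul_div_comm, div_le_iff₀ (by positivity)]
          nlinarith
  have hmarkov : (#{f : κ → V | τ * W < #{i ∈ S | f (key i) ∈ T}} : ℝ) * Real.exp τ ≤
      ∑ f : κ → V, Real.exp (#{i ∈ S | f (key i) ∈ T} / W) := by
    rw [← nsmul_eq_mul, ← sum_const]
    refine (sum_le_sum fun f hf => ?_).trans
      (sum_le_univ_sum_of_nonneg fun f => (Real.exp_pos _).le)
    simp only [mem_filter, mem_univ, true_and] at hf
    rw [Real.exp_le_exp, le_div_iff₀ hW0]
    exact hf.le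
  unfold Rare
  rw [Real.exp_sub, div_mul_eq_mul_div, le_div_iff₀ (Real.exp_pos _), mul_comm (Real.exp 2)]
  convert hmarkov.trans hmoment

/-! ### Encoding sets of words as bit strings -/

theorem List.flatMap_injective_of_length {α β : Type*} {w : ℕ} (hw : 0 < w) {φ : α → List β}
    (hφ : Function.Injective φ) (hlen : ∀ a, (φ a).length = w) :
    Function.Injective fun l : List α => l.flatMap φ := by
  intro l
  induction l with
  | nil =>
    rintro (_ | ⟨b, l'⟩) h
    · rfl
    · have := congrArg List.length h
      simp [hlen] at this
      omega
  | cons a l ih =>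
    rintro (_ | ⟨b, l'⟩) h
    · have := congrArg List.length h
      simp [hlen] at this
      omega
    · simp only [List.flatMap_cons] at h
      obtain ⟨h1, h2⟩ := List.append_inj h (by rw [hlen, hlen])
      rw [hφ h1, ih h2]

/-- Codewords of a fixed positive length can be concatenated without separators, so there is no
overhead and the empty message costs nothing. -/
theorem exists_finset_encoding {α : Type*} [Fintype α] {w : ℕ} (hw : 0 < w)
    (hα : Fintype.card α ≤ 2 ^ w) :
    ∃ (enc : Finset α → List Bool) (dec : List Bool → Finset α),
      (∀ s, dec (enc s) = s) ∧ ∀ s, (enc s).length = w * #s := by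
  classical
  obtain ⟨φ⟩ : Nonempty (α ↪ (Fin w → Bool)) :=
    Function.Embedding.nonempty_of_card_le (by simpa using hα)
  let enc : Finset α → List Bool := fun s => s.toList.flatMap fun a => List.ofFn (φ a)
  have hinj : Function.Injective enc := fun s s' h => by
    have := List.flatMap_injective_of_length hw (φ := fun a => List.ofFn (φ a))
      (fun a b hab => φ.injective (List.ofFn_injective hab)) (fun a => by simp) h
    rw [← toList_toFinset s, this, toList_toFinset]
  refine ⟨enc, Function.invFun enc, Function.leftInverse_invFun hinj, fun s => ?_⟩
  simp [enc, List.length_flatMap, mul_comm]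

/-! ### Two-round algorithms whose messages are sets of words -/

/-- A two-round algorithm in which the messages are finite sets of words. -/
structure TwoRound (p : ℕ) (In Out Word Coins : Type) where
  first : Coins → Fin p → In → Fin p → Finset Word
  second : Coins → Fin p → In → (Fin p → Finset Word) → Fin p → Finset Word
  final : Coins → Fin p → In → (Fin p → Finset Word) → (Fin p → Finset Word) → Finset Out

namespace TwoRound

variable {p : ℕ} {In Out Word Coins : Type} (B : TwoRound p In Out Word Coins)

/-- What server `v` receives in the first round. -/
def inbox₁ (ω : Coins) (x : Fin p → In) (v : Fin p) : Fin p → Finset Word :=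
  fun u => B.first ω u (x u) v

/-- What server `v` receives in the second round. -/
def inbox₂ (ω : Coins) (x : Fin p → In) (v : Fin p) : Fin p → Finset Word :=
  fun u => B.second ω u (x u) (B.inbox₁ ω x u) v

/-- The algorithm that sends encoded sets of words. -/
def toMPC [Fintype Coins] [Nonempty Coins] (enc : Finset Word → List Bool)
    (dec : List Bool → Finset Word) : MPCAlgorithm p In Out where
  Coins := Coins
  rounds := 2
  send ω u x hist v :=
    match hist with
    | [] => enc (B.first ω u x v)
    | i :: _ => enc (B.second ω u x (fun u' => dec (i u')) v)
  output ω u x hist :=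
    match hist with
    | i :: i' :: _ => B.final ω u x (fun u' => dec (i u')) (fun u' => dec (i' u'))
    | _ => ∅

variable [Fintype Coins] [Nonempty Coins] {enc : Finset Word → List Bool}
  {dec : List Bool → Finset Word}

theorem result_toMPC [DecidableEq Out] (hdec : ∀ s, dec (enc s) = s) (ω : Coins)
    (x : Fin p → In) :
    (B.toMPC enc dec).result ω x =
      univ.biUnion fun v => B.final ω v (x v) (B.inbox₁ ω x v) (B.inbox₂ ω x v) := by
  simp [MPCAlgorithm.result, toMPC, MPCAlgorithm.history, hdec]
  rfl

theorem load_toMPC_le (hdec : ∀ s, dec (enc s) = s) {w : ℕ} (hlen : ∀ s, (enc s).length = w * #s)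
    (ω : Coins) (x : Fin p → In) {b : ℝ} (hb : 0 ≤ b)
    (h₁ : ∀ v, w * ((∑ u, #(B.inbox₁ ω x v u) : ℕ) : ℝ) ≤ b)
    (h₂ : ∀ v, w * ((∑ u, #(B.inbox₂ ω x v u) : ℕ) : ℝ) ≤ b) :
    ((B.toMPC enc dec).load ω x : ℝ) ≤ b := by
  rw [← Nat.le_floor_iff hb]
  unfold MPCAlgorithm.load
  refine Finset.sup_le fun i hi => Finset.sup_le fun v _ => ?_
  rw [Nat.le_floor_iff hb]
  have hi' : i < 2 := by simpa [toMPC] using hi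
  interval_cases i
  · refine le_trans (le_of_eq ?_) (h₁ v)
    simp [MPCAlgorithm.received, toMPC, MPCAlgorithm.history, inbox₁, hlen, mul_sum]
  · refine le_trans (le_of_eq ?_) (h₂ v)
    simp [MPCAlgorithm.received, toMPC, MPCAlgorithm.history, inbox₂, hlen, mul_sum, hdec]
    rfl

end TwoRound

/-! ### The algorithm for the triangle query -/

/-- A message word: `(some s, j, x, r)` is the `r`-th report that the value `x` is locally frequent
on the side `s` of the relation `j`; `(none, j, e)` says that `e` is a tuple of the relation `j`. -/
abbrev Word (n : ℕ) : Type := Option Bool × Fin 3 × Fin n × Fin n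

/-- One hash function for each variable; single values `x` are hashed as `(x, x)`. -/
abbrev Hashes (p n : ℕ) : Type := Fin 3 → Fin n × Fin n → Fin p

/-- The variable on the first (`false`) or the second (`true`) side of a relation. -/
def sideVar (j : Fin 3) (s : Bool) : Fin 3 := if s then j + 1 else j

/-- The value on the first (`false`) or the second (`true`) side of a tuple. -/
def side {n : ℕ} (s : Bool) (e : Fin n × Fin n) : Fin n := if s then e.2 else e.1

/-- The number of tuples of the relation `j` with value `x` on the side `s`. -/
def degree {n : ℕ} (F : TriangleInstance n) (j : Fin 3) (s : Bool) (x : Fin n) : ℕ :=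
  #{e ∈ F j | side s e = x}

/-- The parameters of the algorithm: `t` is the local degree that causes a report, `θ` the number
of reports that make a value heavy, `bucket` groups the hash values, and `cell` arranges the
servers in a cube. -/
structure Params (p q : ℕ) where
  t : ℕ
  θ : ℕ
  bucket : Fin p → Fin q
  cell : Fin p → Fin 3 → Fin q

open Classical in
/-- The reports of a server with fragment `F`. -/
noncomputable def reports {n : ℕ} (t : ℕ) (F : TriangleInstance n) : Finset (Word n) :=
  {w | ∃ s, w.1 = some s ∧ ((w.2.2.2 : ℕ) + 1) * t ≤ degree F w.2.1 s w.2.2.1}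

open Classical in
/-- The words in which the tuples of `E` are sent. -/
noncomputable def tupleWords {n : ℕ} (E : Fin 3 → Fin n × Fin n → Prop) : Finset (Word n) :=
  {w | w.1 = none ∧ E w.2.1 w.2.2}

/-- The tuples that a server with fragment `F` sends to `v` in the first round. -/
def routed {p n : ℕ} (t : ℕ) (ω : Hashes p n) (F : TriangleInstance n) (v : Fin p) (j : Fin 3)
    (e : Fin n × Fin n) : Prop :=
  e ∈ F j ∧ ∃ s, degree F j s (side s e) < t ∧ ω (sideVar j s) (side s e, side s e) = v

open Classical in
/-- The reports in an inbox. -/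
noncomputable def reportsIn {p n : ℕ} (i : Fin p → Finset (Word n)) (u : Fin p) :
    Finset (Word n) :=
  {w ∈ i u | w.1 ≠ none}

/-- The value `x` of the variable `k` has been reported. -/
def Reported {p n : ℕ} (R : Fin p → Finset (Word n)) (k : Fin 3) (x : Fin n) : Prop :=
  ∃ u, ∃ w ∈ R u, ∃ s, w.1 = some s ∧ sideVar w.2.1 s = k ∧ w.2.2.1 = x

open Classical in
/-- The number of reports of the value `x` on the side `s` of the relation `j`. -/
noncomputable def reportCount {p n : ℕ} (R : Fin p → Finset (Word n)) (j : Fin 3) (s : Bool)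
    (x : Fin n) : ℕ :=
  ∑ u, #{w ∈ R u | w.1 = some s ∧ w.2.1 = j ∧ w.2.2.1 = x}

/-- The value `x` of the variable `k` has been reported at least `θ` times. -/
def Heavy {p n : ℕ} (θ : ℕ) (R : Fin p → Finset (Word n)) (k : Fin 3) (x : Fin n) : Prop :=
  ∃ j s, sideVar j s = k ∧ θ ≤ reportCount R j s x

open Classical in
/-- The tuples known to a server with fragment `F` and inbox `i`. -/
noncomputable def known {p n : ℕ} (F : TriangleInstance n) (i : Fin p → Finset (Word n)) :
    TriangleInstance n :=
  fun j => F j ∪ ({e | ∃ u, (none, j, e) ∈ i u} : Finset (Fin n × Fin n))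

/-- The tuples that are broadcast in the second round. -/
def Broadcast {p n : ℕ} (θ : ℕ) (R : Fin p → Finset (Word n)) (F : TriangleInstance n)
    (j : Fin 3) (e : Fin n × Fin n) : Prop :=
  e ∈ F j ∧ ∃ s, Heavy θ R (sideVar j s) (side s e) ∧ Reported R (sideVar j !s) (side (!s) e)

/-- The tuples without heavy values that are sent to the server `v` of the cube. -/
def InCube {p q n : ℕ} (a : Params p q) (R : Fin p → Finset (Word n)) (ω : Hashes p n)
    (F : TriangleInstance n) (v : Fin p) (j : Fin 3) (e : Fin n × Fin n) : Prop :=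
  e ∈ F j ∧ ∀ s, ¬ Heavy a.θ R (sideVar j s) (side s e) ∧
    a.bucket (ω (sideVar j s) (side s e, side s e)) = a.cell v (sideVar j s)

/-- The tuples that are to close a path that starts in a heavy value. -/
def Closing {p n : ℕ} (ω : Hashes p n) (F : TriangleInstance n) (v : Fin p) (j : Fin 3)
    (e : Fin n × Fin n) : Prop :=
  e ∈ F j ∧ ω (j + 1) (e.2, e.1) = v

/-- The path `x y z` starts in a heavy value `x` of the variable `k` and has no other reported
values. -/
def IsHeavyPath {p n : ℕ} (θ : ℕ) (R : Fin p → Finset (Word n)) (F : TriangleInstance n)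
    (k : Fin 3) (x y z : Fin n) : Prop :=
  Heavy θ R k x ∧ (x, y) ∈ F k ∧ (y, z) ∈ F (k + 1) ∧ ¬ Reported R (k + 1) y ∧
    ¬ Reported R (k + 2) z

/-- The tuples on paths that server `u` sends to server `v` in the second round. -/
def PathTuple {p n : ℕ} (θ : ℕ) (R : Fin p → Finset (Word n)) (ω : Hashes p n)
    (F : TriangleInstance n) (u v : Fin p) (j : Fin 3) (e : Fin n × Fin n) : Prop :=
  ∃ k x y z, IsHeavyPath θ R F k x y z ∧ ω (k + 1) (y, y) = u ∧ ω k (x, z) = v ∧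
    (j = k ∧ e = (x, y) ∨ j = k + 1 ∧ e = (y, z))

open Classical in
/-- The two-round algorithm for the triangle query. -/
noncomputable def triangleAlgorithm {p q : ℕ} (n : ℕ) (a : Params p q) :
    TwoRound p (TriangleInstance n) (Fin n × Fin n × Fin n) (Word n) (Hashes p n) where
  first ω _ F v := reports a.t F ∪ tupleWords (routed a.t ω F v)
  second ω u F i v :=
    let R := reportsIn i
    tupleWords fun j e => Broadcast a.θ R F j e ∨ InCube a R ω F v j e ∨ Closing ω F v j e ∨
      PathTuple a.θ R ω (known F i) u v j e
  final _ _ F i i' := triangleQuery (known (known F i) i')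

/-! ### Correctness -/

section Correctness

theorem Fin.eq_or_eq_add_one_or_eq_add_two :
    ∀ k j : Fin 3, j = k ∨ j = k + 1 ∨ j = k + 2 := by decide

theorem Fin.add_one_add_one_of_three : ∀ k : Fin 3, k + 1 + 1 = k + 2 := by decide

theorem Fin.add_two_add_one_of_three : ∀ k : Fin 3, k + 2 + 1 = k := by decide

variable {p q n : ℕ} {a : Params p q} {I : TriangleInstance n}
  {owner : Fin 3 → Fin n × Fin n → Fin p} {ω : Hashes p n}

@[simp]
theorem none_mem_tupleWords {E : Fin 3 → Fin n × Fin n → Prop} {j : Fin 3} {e : Fin n × Fin n} :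
    (none, j, e) ∈ tupleWords E ↔ E j e := by
  simp [tupleWords]

@[simp]
theorem mem_known {F : TriangleInstance n} {i : Fin p → Finset (Word n)} {j : Fin 3}
    {e : Fin n × Fin n} : e ∈ known F i j ↔ e ∈ F j ∨ ∃ u, (none, j, e) ∈ i u := by
  simp [known]

theorem mem_fragment {v : Fin p} {j : Fin 3} {e : Fin n × Fin n} :
    e ∈ fragment I owner v j ↔ e ∈ I j ∧ owner j e = v := by
  simp [fragment]

/-- The reports of all servers on the instance `I`. -/
noncomputable def allReports (t : ℕ) (I : TriangleInstance n)
    (owner : Fin 3 → Fin n × Fin n → Fin p) (u : Fin p) : Finset (Word n) :=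
  reports t (fragment I owner u)

/-- The right side does not depend on `v`: after round one all servers agree on which values are
reported and which are heavy. -/
theorem reportsIn_inbox₁ (v : Fin p) :
    reportsIn ((triangleAlgorithm n a).inbox₁ ω (fragment I owner) v) =
      allReports a.t I owner := by
  ext u w
  simp only [reportsIn, TwoRound.inbox₁, triangleAlgorithm, allReports, mem_filter, mem_union]
  constructor
  · rintro ⟨h | h, h'⟩
    · exact h
    · simp [tupleWords, h'] at h
  · intro h
    refine ⟨Or.inl h, ?_⟩
    simp only [reports, mem_filter, mem_univ, true_and] at h
    obtain ⟨s, hs, -⟩ := h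
    simp [hs]

theorem none_mem_inbox₁ {u v : Fin p} {j : Fin 3} {e : Fin n × Fin n} :
    (none, j, e) ∈ (triangleAlgorithm n a).inbox₁ ω (fragment I owner) v u ↔
      routed a.t ω (fragment I owner u) v j e := by
  simp [TwoRound.inbox₁, triangleAlgorithm, reports]

theorem none_mem_inbox₂ {u v : Fin p} {j : Fin 3} {e : Fin n × Fin n} :
    (none, j, e) ∈ (triangleAlgorithm n a).inbox₂ ω (fragment I owner) v u ↔
      Broadcast a.θ (allReports a.t I owner) (fragment I owner u) j e ∨
      InCube a (allReports a.t I owner) ω (fragment I owner u) v j e ∨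
      Closing ω (fragment I owner u) v j e ∨
      PathTuple a.θ (allReports a.t I owner) ω (known (fragment I owner u)
        ((triangleAlgorithm n a).inbox₁ ω (fragment I owner) u)) u v j e := by
  unfold TwoRound.inbox₂
  simp only [triangleAlgorithm, none_mem_tupleWords]
  rw [← reportsIn_inbox₁ (a := a) (ω := ω) u]
  rfl

theorem known₁_subset {v : Fin p} {j : Fin 3} {e : Fin n × Fin n}
    (h : e ∈ known (fragment I owner v)
      ((triangleAlgorithm n a).inbox₁ ω (fragment I owner) v) j) : e ∈ I j := by
  rw [mem_known] at h
  rcases h with h | ⟨u, h⟩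
  · exact (mem_fragment.1 h).1
  · exact (mem_fragment.1 (none_mem_inbox₁.1 h).1).1

theorem known₂_subset {v : Fin p} {j : Fin 3} {e : Fin n × Fin n}
    (h : e ∈ known (known (fragment I owner v)
      ((triangleAlgorithm n a).inbox₁ ω (fragment I owner) v))
      ((triangleAlgorithm n a).inbox₂ ω (fragment I owner) v) j) : e ∈ I j := by
  rw [mem_known] at h
  rcases h with h | ⟨u, h⟩
  · exact known₁_subset h
  · rcases none_mem_inbox₂.1 h with h | h | h | ⟨k, x, y, z, hp, -, -, ⟨rfl, rfl⟩ | ⟨rfl, rfl⟩⟩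
    · exact (mem_fragment.1 h.1).1
    · exact (mem_fragment.1 h.1).1
    · exact (mem_fragment.1 h.1).1
    · exact known₁_subset hp.2.1
    · exact known₁_subset hp.2.2.1

theorem degree_lt_of_not_reported {t : ℕ} {k j : Fin 3} {s : Bool} {x : Fin n} (hk : sideVar j s = k)
    (h : ¬ Reported (allReports t I owner) k x) (u : Fin p) :
    degree (fragment I owner u) j s x < t := by
  by_contra! h'
  -- Report number `0` is sent as soon as the local degree reaches `(0 + 1) * t`.
  refine h ⟨u, (some s, j, x, ⟨0, x.pos⟩), ?_, s, rfl, hk, rfl⟩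
  simp only [allReports, reports, mem_filter, mem_univ, true_and]
  exact ⟨s, rfl, by simpa using h'⟩

theorem mem_known₁_of_not_reported {j : Fin 3} {s : Bool} {e : Fin n × Fin n} (he : e ∈ I j)
    (h : ¬ Reported (allReports a.t I owner) (sideVar j s) (side s e)) {v : Fin p}
    (hv : ω (sideVar j s) (side s e, side s e) = v) :
    e ∈ known (fragment I owner v)
      ((triangleAlgorithm n a).inbox₁ ω (fragment I owner) v) j := by
  rw [mem_known]
  exact Or.inr ⟨owner j e, none_mem_inbox₁.2 ⟨mem_fragment.2 ⟨he, rfl⟩, s,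
    degree_lt_of_not_reported rfl h _, hv⟩⟩

/-- If some `T k` is heavy, the meeting place depends on which of the other two values are reported.
Both: the owner of the opposite tuple. Exactly one: the hash of the unreported value. None: the hash
of the pair `(T k, T (k + 2))`. If no value is heavy, it is a cell of the cube. -/
theorem triangle_known (hcell : Function.Surjective a.cell) (T : Fin 3 → Fin n)
    (hT : ∀ j, (T j, T (j + 1)) ∈ I j) :
    ∃ v, ∀ j, (T j, T (j + 1)) ∈ known (known (fragment I owner v)
      ((triangleAlgorithm n a).inbox₁ ω (fragment I owner) v))
      ((triangleAlgorithm n a).inbox₂ ω (fragment I owner) v) j := by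
  set R := allReports a.t I owner with hR
  have hfrag : ∀ j, (T j, T (j + 1)) ∈ fragment I owner (owner j (T j, T (j + 1))) j :=
    fun j => mem_fragment.2 ⟨hT j, rfl⟩
  by_cases hH : ∃ k, Heavy a.θ R k (T k)
  · obtain ⟨k, hk⟩ := hH
    have all : ∀ {Q : Fin 3 → Prop}, Q k → Q (k + 1) → Q (k + 2) → ∀ j, Q j := by
      intro Q h0 h1 h2 j
      rcases Fin.eq_or_eq_add_one_or_eq_add_two k j with rfl | rfl | rfl <;> assumption
    have e11 := Fin.add_one_add_one_of_three k
    have e21 := Fin.add_two_add_one_of_three k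
    have bc0 : Reported R (k + 1) (T (k + 1)) → ∀ v, (T k, T (k + 1)) ∈
        known (known (fragment I owner v)
          ((triangleAlgorithm n a).inbox₁ ω (fragment I owner) v))
          ((triangleAlgorithm n a).inbox₂ ω (fragment I owner) v) k := fun h v =>
      mem_known.2 (Or.inr ⟨_, none_mem_inbox₂.2 (Or.inl ⟨hfrag k, false, hk, h⟩)⟩)
    have bc2 : Reported R (k + 2) (T (k + 2)) → ∀ v, (T (k + 2), T (k + 2 + 1)) ∈
        known (known (fragment I owner v)
          ((triangleAlgorithm n a).inbox₁ ω (fragment I owner) v))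
          ((triangleAlgorithm n a).inbox₂ ω (fragment I owner) v) (k + 2) := fun h v =>
      mem_known.2 (Or.inr ⟨_, none_mem_inbox₂.2 (Or.inl ⟨hfrag (k + 2), true, by
        simpa [sideVar, side, e21] using hk, h⟩)⟩)
    have to1 : ∀ {j : Fin 3} (s : Bool),
        ¬ Reported R (sideVar j s) (T (sideVar j s)) →
        ∀ v, ω (sideVar j s) (T (sideVar j s), T (sideVar j s)) = v →
        (T j, T (j + 1)) ∈ known (fragment I owner v)
          ((triangleAlgorithm n a).inbox₁ ω (fragment I owner) v) j := by
      intro j s h v hv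
      have hs : side s (T j, T (j + 1)) = T (sideVar j s) := by cases s <;> rfl
      exact mem_known₁_of_not_reported (hT j) (s := s) (by rwa [hs]) (by rwa [hs])
    by_cases hb : Reported R (k + 1) (T (k + 1)) <;> by_cases hc : Reported R (k + 2) (T (k + 2))
    · exact ⟨owner (k + 1) (T (k + 1), T (k + 1 + 1)), all (bc0 hb _)
        (mem_known.2 (Or.inl (mem_known.2 (Or.inl (hfrag (k + 1)))))) (bc2 hc _)⟩
    · refine ⟨ω (k + 2) (T (k + 2), T (k + 2)), all (bc0 hb _) ?_ ?_⟩
      · refine mem_known.2 (Or.inl (to1 true ?_ _ ?_)) <;> simp [sideVar, e11, hc]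
      · exact mem_known.2 (Or.inl (to1 false hc _ rfl))
    · refine ⟨ω (k + 1) (T (k + 1), T (k + 1)), all ?_ ?_ (bc2 hc _)⟩
      · exact mem_known.2 (Or.inl (to1 true hb _ rfl))
      · exact mem_known.2 (Or.inl (to1 false hb _ rfl))
    -- Since the middle value is unreported, its hash holds both tuples of the path after round one
    -- and can forward them.
    · have hpath : IsHeavyPath a.θ R (known (fragment I owner (ω (k + 1) (T (k + 1), T (k + 1))))
          ((triangleAlgorithm n a).inbox₁ ω (fragment I owner)
            (ω (k + 1) (T (k + 1), T (k + 1))))) k (T k) (T (k + 1)) (T (k + 2)) := by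
        refine ⟨hk, to1 true hb _ rfl, ?_, hb, hc⟩
        have := to1 (j := k + 1) false hb _ rfl
        rwa [e11] at this
      refine ⟨ω k (T k, T (k + 2)), all ?_ ?_ ?_⟩
      · exact mem_known.2 (Or.inr ⟨_, none_mem_inbox₂.2 (Or.inr (Or.inr (Or.inr
          ⟨k, _, _, _, hpath, rfl, rfl, Or.inl ⟨rfl, rfl⟩⟩)))⟩)
      · refine mem_known.2 (Or.inr ⟨_, none_mem_inbox₂.2 (Or.inr (Or.inr (Or.inr
          ⟨k, _, _, _, hpath, rfl, rfl, Or.inr ⟨rfl, ?_⟩⟩)))⟩)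
        rw [e11]
      · refine mem_known.2 (Or.inr ⟨_, none_mem_inbox₂.2 (Or.inr (Or.inr (Or.inl
          ⟨hfrag (k + 2), ?_⟩)))⟩)
        simp [e21]
  · push Not at hH
    obtain ⟨v, hv⟩ := hcell fun j => a.bucket (ω j (T j, T j))
    refine ⟨v, fun j => mem_known.2 (Or.inr ⟨_, none_mem_inbox₂.2 (Or.inr (Or.inl
      ⟨hfrag j, fun s => ?_⟩))⟩)⟩
    have hs : side s (T j, T (j + 1)) = T (sideVar j s) := by cases s <;> rfl
    rw [hs, hv]
    exact ⟨hH _, rfl⟩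

theorem biUnion_final_eq_triangleQuery (hcell : Function.Surjective a.cell) :
    (univ.biUnion fun v => (triangleAlgorithm n a).final ω v (fragment I owner v)
      ((triangleAlgorithm n a).inbox₁ ω (fragment I owner) v)
      ((triangleAlgorithm n a).inbox₂ ω (fragment I owner) v)) = triangleQuery I := by
  ext ⟨x, y, z⟩
  simp only [mem_biUnion, mem_univ, true_and]
  constructor
  · rintro ⟨v, h⟩
    simp only [triangleAlgorithm, triangleQuery, mem_filter, mem_univ, true_and] at h ⊢
    exact ⟨known₂_subset h.1, known₂_subset h.2.1, known₂_subset h.2.2⟩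
  · intro h
    simp only [triangleQuery, mem_filter, mem_univ, true_and] at h
    obtain ⟨v, hv⟩ := triangle_known (a := a) (I := I) (owner := owner) (ω := ω) hcell ![x, y, z]
      (by intro j; fin_cases j <;> simp [h])
    refine ⟨v, ?_⟩
    have h0 := hv 0
    have h1 := hv 1
    have h2 := hv 2
    simp only [triangleAlgorithm, triangleQuery, mem_filter, mem_univ, true_and]
    exact ⟨h0, h1, h2⟩

end Correctness

/-! ### Reports and degrees -/

section Reports

variable {n : ℕ}

theorem eq_of_side_eq_of_side_not_eq {s : Bool} {e e' : Fin n × Fin n} (h : side s e = side s e')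
    (h' : side (!s) e = side (!s) e') : e = e' := by
  cases s <;> simp_all [side, Prod.ext_iff]

theorem degree_le (F : TriangleInstance n) (j : Fin 3) (s : Bool) (x : Fin n) :
    degree F j s x ≤ n := by
  unfold degree
  refine le_of_le_of_eq (card_le_card_of_injOn (t := univ) (side !s) (fun _ _ => mem_univ _)
    fun e he e' he' h => ?_) (card_fin n)
  simp only [coe_filter, Set.mem_ofPred_eq] at he he'
  exact eq_of_side_eq_of_side_not_eq (he.2.trans he'.2.symm) h

theorem sum_degree (F : TriangleInstance n) (j : Fin 3) (s : Bool) :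
    ∑ x, degree F j s x = #(F j) :=
  (card_eq_sum_card_fiberwise (f := side s) (t := univ) fun _ _ => by simp).symm

-- Multiplicities are sent in unary: distinct indices `r` keep the reports distinct in a set.
open Classical in
theorem card_reports_filter {t : ℕ} (ht : 0 < t) (F : TriangleInstance n) (j : Fin 3) (s : Bool)
    (x : Fin n) :
    #{w ∈ reports t F | w.1 = some s ∧ w.2.1 = j ∧ w.2.2.1 = x} = degree F j s x / t := by
  rw [← card_range (degree F j s x / t)]
  refine card_bij (fun w _ => w.2.2.2) ?_ ?_ ?_
  · rintro ⟨o, j', x', r⟩ hw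
    simp only [reports, mem_filter, mem_univ, true_and] at hw
    obtain ⟨⟨s', rfl, h⟩, hs, rfl, rfl⟩ := hw
    obtain rfl := Option.some_injective _ hs
    rw [mem_range, ← Nat.succ_le_iff, Nat.le_div_iff_mul_le ht]
    exact h
  · rintro ⟨o, j', x', r⟩ hw ⟨o', j'', x'', r'⟩ hw' h
    simp only [mem_filter] at hw hw'
    obtain ⟨-, rfl, rfl, rfl⟩ := hw
    obtain ⟨-, rfl, rfl, rfl⟩ := hw'
    simp only [Prod.mk.injEq, true_and]
    exact Fin.ext h
  · intro r hr
    rw [mem_range, ← Nat.succ_le_iff, Nat.le_div_iff_mul_le ht] at hr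
    -- The index fits into `Fin n` because degrees are at most `n` and `t ≥ 1`.
    have hrn : r < n := by
      have := degree_le F j s x
      have : r.succ * 1 ≤ r.succ * t := Nat.mul_le_mul_left _ ht
      omega
    refine ⟨(some s, j, x, ⟨r, hrn⟩), ?_, rfl⟩
    simp only [reports, mem_filter, mem_univ, true_and, and_self, and_true]
    exact ⟨s, rfl, hr⟩

theorem card_reports {t : ℕ} (ht : 0 < t) (F : TriangleInstance n) :
    #(reports t F) = ∑ j, ∑ s, ∑ x, degree F j s x / t := by
  classical
  have h : ∀ w ∈ reports t F, ((w.2.1, w.1.getD false, w.2.2.1) : Fin 3 × Bool × Fin n) ∈ univ :=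
    fun _ _ => mem_univ _
  rw [card_eq_sum_card_fiberwise h, Fintype.sum_prod_type]
  refine sum_congr rfl fun j _ => ?_
  rw [Fintype.sum_prod_type]
  refine sum_congr rfl fun s _ => sum_congr rfl fun x _ => ?_
  rw [← card_reports_filter ht]
  congr 1
  refine filter_congr fun w hw => ?_
  simp only [reports, mem_filter, mem_univ, true_and] at hw
  obtain ⟨s', hs', -⟩ := hw
  simp [hs', Prod.ext_iff]
  tauto

theorem mul_card_reports_le {t : ℕ} (ht : 0 < t) (F : TriangleInstance n) :
    t * #(reports t F) ≤ 2 * ∑ j, #(F j) := by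
  rw [card_reports ht, mul_sum, mul_sum]
  refine sum_le_sum fun j _ => ?_
  rw [mul_sum]
  calc ∑ s, t * ∑ x, degree F j s x / t ≤ ∑ _s : Bool, #(F j) := by
        refine sum_le_sum fun s _ => ?_
        rw [← sum_degree F j s, mul_sum]
        exact sum_le_sum fun x _ => Nat.mul_div_le _ _
    _ = 2 * #(F j) := by simp

variable {p : ℕ} (I : TriangleInstance n) (owner : Fin 3 → Fin n × Fin n → Fin p)

theorem sum_card_fragment (j : Fin 3) : ∑ u, #(fragment I owner u j) = #(I j) :=
  (card_eq_sum_card_fiberwise (f := owner j) (t := univ) fun _ _ => by simp).symm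

theorem sum_degree_fragment (j : Fin 3) (s : Bool) (x : Fin n) :
    ∑ u, degree (fragment I owner u) j s x = degree I j s x := by
  unfold degree
  rw [card_eq_sum_card_fiberwise (f := owner j) (t := univ) fun _ _ => by simp]
  refine sum_congr rfl fun u _ => ?_
  rw [fragment, filter_filter, filter_filter]
  simp only [and_comm]

theorem mul_sum_card_allReports_le {t : ℕ} (ht : 0 < t) :
    t * ∑ u, #(allReports t I owner u) ≤ 2 * ∑ j, #(I j) := by
  calc t * ∑ u, #(allReports t I owner u) ≤ ∑ u, 2 * ∑ j, #(fragment I owner u j) := by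
        rw [mul_sum]
        exact sum_le_sum fun u _ => mul_card_reports_le ht _
    _ = 2 * ∑ j, #(I j) := by
        rw [← mul_sum, sum_comm]
        simp only [sum_card_fragment]

theorem reportCount_allReports {t : ℕ} (ht : 0 < t) (j : Fin 3) (s : Bool) (x : Fin n) :
    reportCount (allReports t I owner) j s x = ∑ u, degree (fragment I owner u) j s x / t :=
  sum_congr rfl fun _ _ => card_reports_filter ht _ _ _ _

theorem mul_reportCount_le {t : ℕ} (ht : 0 < t) (j : Fin 3) (s : Bool) (x : Fin n) :
    t * reportCount (allReports t I owner) j s x ≤ degree I j s x := by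
  rw [reportCount_allReports I owner ht, mul_sum, ← sum_degree_fragment I owner]
  exact sum_le_sum fun u _ => Nat.mul_div_le _ _

/-- Each of the `p` servers rounds its local degree down to a multiple of `t`, losing less than `t`.
-/
theorem degree_le_mul_reportCount_add {t : ℕ} (ht : 0 < t) (j : Fin 3) (s : Bool) (x : Fin n) :
    degree I j s x ≤ t * (reportCount (allReports t I owner) j s x + p) := by
  rw [reportCount_allReports I owner ht, ← sum_degree_fragment I owner]
  calc ∑ u, degree (fragment I owner u) j s x
      ≤ ∑ u, t * (degree (fragment I owner u) j s x / t + 1) :=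
        sum_le_sum fun u _ => (Nat.lt_mul_div_succ _ ht).le
    _ = _ := by rw [← mul_sum, sum_add_distrib]; simp

theorem degree_le_of_not_reported {t : ℕ} {k j : Fin 3} {s : Bool} {x : Fin n}
    (hk : sideVar j s = k) (h : ¬ Reported (allReports t I owner) k x) :
    degree I j s x ≤ t * p := by
  rw [← sum_degree_fragment I owner]
  calc ∑ u, degree (fragment I owner u) j s x ≤ ∑ _u : Fin p, t :=
        sum_le_sum fun u _ => (degree_lt_of_not_reported hk h u).le
    _ = t * p := by simp [mul_comm]

theorem degree_le_of_not_heavy {t θ : ℕ} (ht : 0 < t) {k j : Fin 3} {s : Bool} {x : Fin n}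
    (hk : sideVar j s = k) (h : ¬ Heavy θ (allReports t I owner) k x) :
    degree I j s x ≤ t * (θ + p) := by
  refine (degree_le_mul_reportCount_add I owner ht j s x).trans ?_
  have : reportCount (allReports t I owner) j s x < θ := by
    by_contra! h'
    exact h ⟨j, s, hk, h'⟩
  gcongr

open Classical in
/-- The reported values of the variable `k`. -/
noncomputable def reportedValues (R : Fin p → Finset (Word n)) (k : Fin 3) : Finset (Fin n) :=
  {x | Reported R k x}

open Classical in
/-- The heavy values of the variable `k`. -/
noncomputable def heavyValues (θ : ℕ) (R : Fin p → Finset (Word n)) (k : Fin 3) :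
    Finset (Fin n) :=
  {x | Heavy θ R k x}

theorem card_reportedValues_le (R : Fin p → Finset (Word n)) (k : Fin 3) :
    #(reportedValues R k) ≤ ∑ u, #(R u) := by
  classical
  calc #(reportedValues R k) ≤ #(univ.biUnion fun u => (R u).image fun w => w.2.2.1) := by
        refine card_le_card fun x hx => ?_
        simp only [reportedValues, mem_filter, mem_univ, true_and] at hx
        obtain ⟨u, w, hw, s, -, -, rfl⟩ := hx
        simp only [mem_biUnion, mem_univ, true_and, mem_image]
        exact ⟨u, w, hw, rfl⟩
    _ ≤ _ := card_biUnion_le.trans (sum_le_sum fun u _ => card_image_le)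

/-- A heavy value uses up degree at least `t * θ` on some side of some relation, and the degrees on
each side of a relation sum to its size. -/
theorem mul_card_heavyValues_le {t : ℕ} (ht : 0 < t) (θ : ℕ) (k : Fin 3) :
    t * θ * #(heavyValues θ (allReports t I owner) k) ≤ 2 * ∑ j, #(I j) := by
  classical
  calc t * θ * #(heavyValues θ (allReports t I owner) k)
      ≤ t * θ * ∑ j, ∑ s, #{x | θ ≤ reportCount (allReports t I owner) j s x} := by
        refine Nat.mul_le_mul_left _ ?_
        rw [← Fintype.sum_prod_type']
        refine le_trans (card_le_card fun x hx => ?_) card_biUnion_le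
        simp only [heavyValues, mem_filter, mem_univ, true_and] at hx
        obtain ⟨j, s, -, h⟩ := hx
        simp only [mem_biUnion, mem_univ, true_and, mem_filter]
        exact ⟨(j, s), h⟩
    _ ≤ ∑ j, ∑ _s : Bool, #(I j) := by
        rw [mul_sum]
        refine sum_le_sum fun j _ => ?_
        rw [mul_sum]
        refine sum_le_sum fun s _ => ?_
        rw [← sum_degree I j s, mul_comm, ← smul_eq_mul, ← sum_const]
        refine (sum_le_sum fun x hx => ?_).trans (sum_le_univ_sum_of_nonneg fun _ => Nat.zero_le _)
        simp only [mem_filter, mem_univ, true_and] at hx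
        exact (Nat.mul_le_mul_left _ hx).trans (mul_reportCount_le I owner ht j s x)
    _ = _ := by simp [mul_sum]

end Reports

/-! ### Random loads -/

/-- The parameters `a` fit `p` servers, `m` tuples per relation and a cube of side `q`. -/
structure Params.Fits {p q : ℕ} (a : Params p q) (m : ℕ) : Prop where
  q_pos : 0 < q
  le_p : q ^ 3 ≤ p
  p_le : p ≤ 8 * q ^ 3
  le_m : q ^ 8 ≤ m
  t_eq : a.t = m / q ^ 5
  θ_eq : a.θ = q ^ 4
  bucket : ∀ i, #{v | a.bucket v = i} * q ≤ 2 * p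
  cell : Function.Surjective a.cell

/-! ### Counting bounds in terms of the unit `m / q ^ 2` -/

namespace Params.Fits

variable {p q m : ℕ} {a : Params p q} (ha : a.Fits m)
include ha

theorem q_pos' : (0 : ℝ) < q := by exact_mod_cast ha.q_pos

theorem one_le_q : (1 : ℝ) ≤ q := by exact_mod_cast ha.q_pos

theorem p_pos : 0 < p := (pow_pos ha.q_pos 3).trans_le ha.le_p

theorem le_p' : (q : ℝ) ^ 3 ≤ p := by exact_mod_cast ha.le_p

theorem p_le' : (p : ℝ) ≤ 8 * q ^ 3 := by exact_mod_cast ha.p_le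

theorem m_eq : (m : ℝ) = m / q ^ 2 * q ^ 2 := by
  have := ha.q_pos'
  field_simp

theorem pow_six_le : (q : ℝ) ^ 6 ≤ m / q ^ 2 := by
  have := ha.q_pos'
  rw [le_div_iff₀ (by positivity), ← pow_add]
  exact_mod_cast ha.le_m

theorem one_le_unit : (1 : ℝ) ≤ m / q ^ 2 := (one_le_pow₀ ha.one_le_q).trans ha.pow_six_le

theorem t_pos : 0 < a.t := by
  rw [ha.t_eq]
  exact Nat.div_pos ((Nat.pow_le_pow_right ha.q_pos (by norm_num)).trans ha.le_m)
    (pow_pos ha.q_pos 5)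

/-- As `t ≥ 1`, rounding `m / q ^ 5` down loses at most a factor `2`. -/
theorem m_le : m ≤ 2 * q ^ 5 * a.t := by
  have h := (Nat.lt_mul_div_succ m (pow_pos ha.q_pos 5)).le
  rw [← ha.t_eq] at h
  have : q ^ 5 * (a.t + 1) ≤ q ^ 5 * (2 * a.t) := Nat.mul_le_mul_left _ (by have := ha.t_pos; omega)
  linarith

theorem t_le : (a.t : ℝ) * q ^ 3 ≤ m / q ^ 2 := by
  have := ha.q_pos'
  rw [le_div_iff₀ (by positivity), mul_assoc, ← pow_add, ha.t_eq]
  exact_mod_cast Nat.div_mul_le_self _ _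

theorem t_mul_p_le : (a.t : ℝ) * p ≤ 8 * (m / q ^ 2) := by
  have h1 := ha.t_le
  have h2 : (a.t : ℝ) * p ≤ a.t * (8 * q ^ 3) := by gcongr; exact ha.p_le'
  linarith

theorem t_mul_θ_add_p_le : (a.t : ℝ) * (a.θ + p) ≤ 9 * (m / q ^ 2) * q := by
  have h1 := mul_le_mul_of_nonneg_right ha.t_le ha.q_pos'.le
  have h2 := ha.t_mul_p_le
  have h3 : 8 * ((m : ℝ) / q ^ 2) * 1 ≤ 8 * (m / q ^ 2) * q := by
    gcongr
    exact ha.one_le_q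
  rw [ha.θ_eq]
  push_cast
  nlinarith

variable {n : ℕ} {I : TriangleInstance n} (hI : ∀ j, #(I j) = m)
  (owner : Fin 3 → Fin n × Fin n → Fin p)
include hI

theorem sum_card_allReports_le : ∑ u, #(allReports a.t I owner u) ≤ 12 * q ^ 5 := by
  have h := mul_sum_card_allReports_le I owner ha.t_pos
  simp only [hI, sum_const, card_univ, Fintype.card_fin, smul_eq_mul] at h
  refine Nat.le_of_mul_le_mul_left ?_ ha.t_pos
  have := ha.m_le
  linarith

theorem card_reportedValues_le (k : Fin 3) :
    #(reportedValues (allReports a.t I owner) k) ≤ 12 * q ^ 5 :=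
  (_root_.card_reportedValues_le _ k).trans (ha.sum_card_allReports_le hI owner)

theorem card_heavyValues_le (k : Fin 3) :
    #(heavyValues a.θ (allReports a.t I owner) k) ≤ 12 * q := by
  have h := mul_card_heavyValues_le I owner ha.t_pos a.θ k
  simp only [hI, sum_const, card_univ, Fintype.card_fin, smul_eq_mul] at h
  have h2 := ha.m_le
  refine Nat.le_of_mul_le_mul_left (c := a.t * a.θ) ?_
    (Nat.mul_pos ha.t_pos (by rw [ha.θ_eq]; exact pow_pos ha.q_pos 4))
  calc _ ≤ _ := h
    _ ≤ 2 * (3 * (2 * q ^ 5 * a.t)) := by gcongr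
    _ = a.t * a.θ * (12 * q) := by rw [ha.θ_eq]; ring

omit hI

theorem degree_le_of_not_reported {k j : Fin 3} {s : Bool} {x : Fin n} (hk : sideVar j s = k)
    (h : ¬ Reported (allReports a.t I owner) k x) :
    (degree I j s x : ℝ) ≤ 8 * (m / q ^ 2) :=
  le_trans (by exact_mod_cast _root_.degree_le_of_not_reported I owner hk h) ha.t_mul_p_le

theorem degree_le_of_not_heavy {k j : Fin 3} {s : Bool} {x : Fin n} (hk : sideVar j s = k)
    (h : ¬ Heavy a.θ (allReports a.t I owner) k x) :
    (degree I j s x : ℝ) ≤ 9 * (m / q ^ 2) * q :=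
  le_trans (by exact_mod_cast _root_.degree_le_of_not_heavy I owner ha.t_pos hk h)
    ha.t_mul_θ_add_p_le

end Params.Fits

/-! ### Concentration of the hashed loads, one hash function at a time -/

section Loads

variable {p q n : ℕ}

theorem rare_hash_overload [NeZero p] {ι : Type*} (k : Fin 3) (S : Finset ι)
    (key : ι → Fin n × Fin n) (T : Finset (Fin p)) {W : ℝ} (τ : ℝ) (hW0 : 0 < W)
    (hW : ∀ κ, (#{i ∈ S | key i = κ} : ℝ) ≤ W) (hT : (#T : ℝ) * #S ≤ W * p) :
    Rare (Real.exp (2 - τ)) fun ω : Hashes p n => τ * W < #{i ∈ S | ω k (key i) ∈ T} := by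
  refine Rare.of_update k fun ω => ?_
  simp only [Function.update_self]
  exact rare_overload S key T τ hW0 hW (by simpa using hT)

theorem rare_hash_overload_singleton [NeZero p] {ι : Type*} (k : Fin 3) (S : Finset ι)
    (key : ι → Fin n × Fin n) (v : Fin p) {W : ℝ} (τ : ℝ) (hW0 : 0 < W)
    (hW : ∀ κ, (#{i ∈ S | key i = κ} : ℝ) ≤ W) (hS : (#S : ℝ) ≤ W * p) :
    Rare (Real.exp (2 - τ)) fun ω : Hashes p n => τ * W < #{i ∈ S | ω k (key i) = v} := by
  simpa only [mem_singleton] using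
    rare_hash_overload k S key {v} τ hW0 hW (by simpa using hS)

open Classical in
/-- The tuples of the relation `j` that are sent in the first round because of their side `s`. -/
noncomputable def lightTuples (t : ℕ) (I : TriangleInstance n)
    (owner : Fin 3 → Fin n × Fin n → Fin p) (j : Fin 3) (s : Bool) : Finset (Fin n × Fin n) :=
  {e ∈ I j | degree (fragment I owner (owner j e)) j s (side s e) < t}

open Classical in
/-- The paths that start in a heavy value of the variable `k`. -/
noncomputable def heavyPaths (θ : ℕ) (R : Fin p → Finset (Word n)) (I : TriangleInstance n)
    (k : Fin 3) : Finset (Fin n × Fin n × Fin n) :=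
  {π | IsHeavyPath θ R I k π.1 π.2.1 π.2.2}

open Classical in
/-- The tuples of the relation `j` without heavy values. -/
noncomputable def cubeTuples (θ : ℕ) (R : Fin p → Finset (Word n)) (I : TriangleInstance n)
    (j : Fin 3) : Finset (Fin n × Fin n) :=
  {e ∈ I j | ∀ s, ¬ Heavy θ R (sideVar j s) (side s e)}

/-- A server routes tuples through `x` only if it has fewer than `t` of them, so this holds even
when `x` is heavy. -/
theorem card_lightTuples_fiber_le (t : ℕ) (I : TriangleInstance n)
    (owner : Fin 3 → Fin n × Fin n → Fin p) (j : Fin 3) (s : Bool) (x : Fin n) :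
    #{e ∈ lightTuples t I owner j s | side s e = x} ≤ t * p := by
  classical
  rw [card_eq_sum_card_fiberwise (f := owner j) (t := univ) fun _ _ => by simp]
  calc _ ≤ ∑ _u : Fin p, t := sum_le_sum fun u _ => ?_
    _ = t * p := by simp [mul_comm]
  by_cases h : degree (fragment I owner u) j s x < t
  · refine (card_le_card fun e he => ?_).trans h.le
    simp only [lightTuples, mem_filter] at he
    simp only [mem_filter, mem_fragment]
    tauto
  · rw [card_eq_zero.2]
    · exact Nat.zero_le _
    · rw [eq_empty_iff_forall_notMem]
      intro e he
      simp only [lightTuples, mem_filter] at he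
      obtain ⟨⟨⟨-, h'⟩, rfl⟩, rfl⟩ := he
      exact h h'

variable {m : ℕ} {a : Params p q} (ha : a.Fits m) {I : TriangleInstance n}
  (hI : ∀ j, #(I j) = m) (owner : Fin 3 → Fin n × Fin n → Fin p) (τ : ℝ)
include ha hI

theorem rare_lightTuples (j : Fin 3) (s : Bool) (v : Fin p) :
    Rare (Real.exp (2 - τ)) fun ω : Hashes p n => τ * (12 * (m / q ^ 2)) <
      #{e ∈ lightTuples a.t I owner j s | ω (sideVar j s) (side s e, side s e) = v} := by
  classical
  have : NeZero p := ⟨ha.p_pos.ne'⟩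
  have h1 := ha.one_le_unit
  have hq := ha.one_le_q
  refine rare_hash_overload_singleton (sideVar j s) _ (fun e => (side s e, side s e)) v τ
    (by positivity) (fun κ => ?_) ?_
  · calc (#{e ∈ lightTuples a.t I owner j s | (side s e, side s e) = κ} : ℝ)
        ≤ #{e ∈ lightTuples a.t I owner j s | side s e = κ.1} := by
          refine Nat.cast_le.2 (card_le_card fun e he => ?_)
          simp only [mem_filter] at he ⊢
          exact ⟨he.1, by rw [← he.2]⟩
      _ ≤ a.t * p := by exact_mod_cast card_lightTuples_fiber_le _ _ _ _ _ _
      _ ≤ _ := ha.t_mul_p_le.trans (by linarith)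
  · have h2 : (#(lightTuples a.t I owner j s) : ℝ) ≤ m := by
      rw [← hI j]
      exact Nat.cast_le.2 (card_filter_le _ _)
    have h3 : (m : ℝ) / q ^ 2 * q ^ 2 ≤ m / q ^ 2 * p := by
      gcongr
      refine le_trans ?_ ha.le_p'
      exact pow_le_pow_right₀ hq (by norm_num)
    rw [← ha.m_eq] at h3
    linarith [m.cast_nonneg (α := ℝ)]

theorem rare_closing (j : Fin 3) (v : Fin p) :
    Rare (Real.exp (2 - τ)) fun ω : Hashes p n => τ * (12 * (m / q ^ 2)) <
      #{e ∈ I j | ω (j + 1) (e.2, e.1) = v} := by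
  classical
  have : NeZero p := ⟨ha.p_pos.ne'⟩
  have h1 := ha.one_le_unit
  have hq := ha.one_le_q
  have := rare_hash_overload_singleton (j + 1) (I j) (fun e => (e.2, e.1)) v
    (W := 12 * (m / q ^ 2)) τ (by positivity) (fun κ => ?_) ?_
  · exact this
  · refine le_trans (b := (1 : ℝ)) ?_ (by linarith)
    rw [Nat.cast_le_one, card_le_one]
    intro e he e' he'
    simp only [mem_filter] at he he'
    have := he.2.trans he'.2.symm
    simp only [Prod.mk.injEq] at this
    exact Prod.ext this.2 this.1
  · have h3 : (m : ℝ) / q ^ 2 * q ^ 2 ≤ m / q ^ 2 * p := by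
      gcongr
      refine le_trans ?_ ha.le_p'
      exact pow_le_pow_right₀ hq (by norm_num)
    rw [← ha.m_eq] at h3
    rw [hI]
    linarith [m.cast_nonneg (α := ℝ)]

theorem card_heavyPaths_le (k : Fin 3) :
    #(heavyPaths a.θ (allReports a.t I owner) I k) ≤ 12 * q * m := by
  classical
  calc _ ≤ #(heavyValues a.θ (allReports a.t I owner) k ×ˢ I (k + 1)) := by
        refine card_le_card fun π hπ => ?_
        simp only [heavyPaths, mem_filter, mem_univ, true_and] at hπ
        simp only [mem_product, heavyValues, mem_filter, mem_univ, true_and]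
        exact ⟨hπ.1, hπ.2.2.1⟩
    _ ≤ _ := by
        rw [card_product, hI]
        exact Nat.mul_le_mul_right _ (ha.card_heavyValues_le hI owner k)

/-- The paths with ends `(x, z)` are determined by their middle values, so there are at most as many
as the degree of `z`, which is small because `z` is unreported. -/
theorem rare_heavyPaths (k : Fin 3) (v : Fin p) :
    Rare (Real.exp (2 - τ)) fun ω : Hashes p n => τ * (12 * (m / q ^ 2)) <
      #{π ∈ heavyPaths a.θ (allReports a.t I owner) I k | ω k (π.1, π.2.2) = v} := by
  classical
  have : NeZero p := ⟨ha.p_pos.ne'⟩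
  have h1 := ha.one_le_unit
  have hq := ha.one_le_q
  have := rare_hash_overload_singleton k
    (heavyPaths a.θ (allReports a.t I owner) I k) (fun π => (π.1, π.2.2)) v
    (W := 12 * (m / q ^ 2)) τ (by positivity) (fun κ => ?_) ?_
  · exact this
  · by_cases hκ : Reported (allReports a.t I owner) (k + 2) κ.2
    · rw [card_eq_zero.2]
      · simp only [Nat.cast_zero]; positivity
      · rw [eq_empty_iff_forall_notMem]
        rintro π hπ
        simp only [mem_filter, heavyPaths, mem_univ, true_and] at hπ
        obtain ⟨h, rfl⟩ := hπ
        exact h.2.2.2.2 hκ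
    · have hs : sideVar (k + 1) true = k + 2 := Fin.add_one_add_one_of_three k
      have h2 := ha.degree_le_of_not_reported owner hs hκ
      refine le_trans (Nat.cast_le.2 ?_) (h2.trans (by linarith))
      refine card_le_card_of_injOn (fun π => (π.2.1, π.2.2)) (fun π hπ => ?_)
        fun π hπ π' hπ' h => ?_
      · simp only [coe_filter, Set.mem_ofPred_eq, heavyPaths, mem_filter, mem_univ, true_and]
          at hπ ⊢
        obtain ⟨h, rfl⟩ := hπ
        exact ⟨h.2.2.1, rfl⟩
      · simp only [coe_filter, Set.mem_ofPred_eq, heavyPaths, mem_filter, mem_univ, true_and]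
          at hπ hπ'
        have h3 := hπ.2.trans hπ'.2.symm
        simp only [Prod.mk.injEq] at h h3
        exact Prod.ext h3.1 (Prod.ext h.1 h.2)
  · have h2 : (#(heavyPaths a.θ (allReports a.t I owner) I k) : ℝ) ≤ 12 * q * m := by
      exact_mod_cast card_heavyPaths_le ha hI owner k
    rw [ha.m_eq] at h2
    refine h2.trans ?_
    calc 12 * (q : ℝ) * (m / q ^ 2 * q ^ 2) = 12 * (m / q ^ 2) * q ^ 3 := by ring
      _ ≤ _ := by gcongr; exact ha.le_p'

end Loads

/-! ### The load of the cube -/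

section Cube

variable {p q n m : ℕ} {a : Params p q} (ha : a.Fits m) {I : TriangleInstance n}
  (hI : ∀ j, #(I j) = m) (owner : Fin 3 → Fin n × Fin n → Fin p) {τ : ℝ}
include ha

theorem bucket_card_mul_le (c : Fin q) {x : ℝ} (hx : 0 ≤ x) :
    (#{v | a.bucket v = c} : ℝ) * (x * q) ≤ 2 * x * p := by
  have h : (#{v | a.bucket v = c} : ℝ) * q ≤ 2 * p := by exact_mod_cast ha.bucket c
  nlinarith [mul_le_mul_of_nonneg_left h hx]

theorem card_cubeTuples_fiber_le (j : Fin 3) (s : Bool) (x : Fin n) :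
    (#{e ∈ cubeTuples a.θ (allReports a.t I owner) I j | side s e = x} : ℝ) ≤
      9 * (m / q ^ 2) * q := by
  classical
  by_cases hx : Heavy a.θ (allReports a.t I owner) (sideVar j s) x
  · rw [card_eq_zero.2]
    · have := ha.q_pos'
      simp only [Nat.cast_zero]
      positivity
    · rw [eq_empty_iff_forall_notMem]
      intro e he
      simp only [mem_filter, cubeTuples] at he
      obtain ⟨⟨-, h⟩, rfl⟩ := he
      exact h s hx
  · refine le_trans (Nat.cast_le.2 (card_le_card ?_)) (ha.degree_le_of_not_heavy owner rfl hx)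
    exact filter_subset_filter _ (filter_subset _ _)

include hI

omit ha in
theorem card_cubeTuples_le (j : Fin 3) :
    (#(cubeTuples a.θ (allReports a.t I owner) I j) : ℝ) ≤ m := by
  classical
  rw [← hI j]
  exact Nat.cast_le.2 (card_filter_le _ _)

/-- A bucket contains at most a `2 / q` fraction of the hash values, and without heavy values no key
carries more than `9 * (m / q ^ 2) * q` tuples. -/
theorem rare_row (τ : ℝ) (j : Fin 3) (c : Fin q) :
    Rare (Real.exp (2 - τ)) fun ω : Hashes p n => τ * (18 * (m / q ^ 2) * q) <
      #{e ∈ cubeTuples a.θ (allReports a.t I owner) I j | a.bucket (ω j (e.1, e.1)) = c} := by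
  classical
  have : NeZero p := ⟨ha.p_pos.ne'⟩
  have h1 := ha.one_le_unit
  have hq := ha.one_le_q
  have hpos : 0 < (m : ℝ) / q ^ 2 * q := by positivity
  have := rare_hash_overload (n := n) j (cubeTuples a.θ (allReports a.t I owner) I j)
    (fun e => (e.1, e.1)) {v | a.bucket v = c} (W := 18 * (m / q ^ 2) * q) τ (by positivity)
    (fun κ => ?_) ?_
  · simpa using this
  · refine le_trans (Nat.cast_le.2 (card_le_card fun e he => ?_))
      ((card_cubeTuples_fiber_le ha (I := I) owner j false κ.1).trans (by linarith))
    simp only [mem_filter] at he ⊢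
    exact ⟨he.1, by rw [← he.2]; rfl⟩
  · calc _ ≤ (#{v | a.bucket v = c} : ℝ) * (m / q ^ 2 * q * q) := by
          gcongr
          refine (card_cubeTuples_le hI owner j).trans_eq ?_
          rw [mul_assoc, ← sq, ← ha.m_eq]
      _ ≤ 2 * (m / q ^ 2 * q) * p := bucket_card_mul_le ha c hpos.le
      _ ≤ _ := by
          refine mul_le_mul_of_nonneg_right ?_ p.cast_nonneg
          linarith

-- For fixed `y` each first coordinate occurs at most once, so all keys have weight at most `1`.
-- This controls the share of `y` in a row before the second coordinate is hashed.
omit hI in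
theorem rare_cell_column (τ : ℝ) (j : Fin 3) (c : Fin q) (y : Fin n) :
    Rare (Real.exp (2 - τ)) fun ω : Hashes p n => τ * (18 * (m / q ^ 2)) <
      #{e ∈ {e ∈ cubeTuples a.θ (allReports a.t I owner) I j | side true e = y} |
        a.bucket (ω j (e.1, e.1)) = c} := by
  classical
  have : NeZero p := ⟨ha.p_pos.ne'⟩
  have h1 := ha.one_le_unit
  have hq := ha.one_le_q
  have := rare_hash_overload (n := n) j
    {e ∈ cubeTuples a.θ (allReports a.t I owner) I j | side true e = y}
    (fun e => (e.1, e.1)) {v | a.bucket v = c} (W := 18 * (m / q ^ 2)) τ (by positivity)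
    (fun κ => ?_) ?_
  · simpa using this
  · refine le_trans (b := (1 : ℝ)) ?_ (by linarith)
    rw [Nat.cast_le_one, card_le_one]
    intro e he e' he'
    simp only [mem_filter] at he he'
    have h2 := he.2.trans he'.2.symm
    simp only [Prod.mk.injEq] at h2
    exact Prod.ext h2.1 (he.1.2.trans he'.1.2.symm)
  · calc _ ≤ (#{v | a.bucket v = c} : ℝ) * (9 * (m / q ^ 2) * q) := by
          gcongr
          exact card_cubeTuples_fiber_le ha owner j true y
      _ ≤ 2 * (9 * (m / q ^ 2)) * p := bucket_card_mul_le ha c (by positivity)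
      _ = _ := by ring

/-- The values on the second side of the relation `j` that are too frequent for a single cell of
the cube. -/
noncomputable def frequentValues (q m : ℕ) (I : TriangleInstance n) (j : Fin 3) :
    Finset (Fin n) :=
  {y | (m : ℝ) / q ^ 2 ≤ degree I j true y}

/-- Makes the union bound over columns depend on `q` only and not on the domain size. -/
theorem card_frequentValues_le (j : Fin 3) : #(frequentValues q m I j) ≤ q ^ 2 := by
  have h1 := ha.one_le_unit
  have h2 : (#(frequentValues q m I j) : ℝ) * (m / q ^ 2) ≤ m := by
    rw [← nsmul_eq_mul, ← sum_const]
    calc ∑ _y ∈ frequentValues q m I j, (m : ℝ) / q ^ 2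
        ≤ ∑ y ∈ frequentValues q m I j, (degree I j true y : ℝ) :=
          sum_le_sum fun y hy => by simpa [frequentValues] using hy
      _ ≤ ∑ y, (degree I j true y : ℝ) :=
          sum_le_univ_sum_of_nonneg fun _ => Nat.cast_nonneg _
      _ = m := by exact_mod_cast (sum_degree I j true).trans (hI j)
  have h3 := ha.m_eq
  rw [mul_comm (m / q ^ 2 : ℝ)] at h3
  have h4 := le_of_mul_le_mul_right (h2.trans_eq h3) (by linarith)
  exact_mod_cast h4

/-- The balance of a row of the cube before the second coordinate is hashed. -/
def RowBalanced (a : Params p q) (m : ℕ) (I : TriangleInstance n)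
    (owner : Fin 3 → Fin n × Fin n → Fin p) (τ : ℝ) (j : Fin 3) (c : Fin q)
    (f : Fin n × Fin n → Fin p) : Prop :=
  (#{e ∈ cubeTuples a.θ (allReports a.t I owner) I j | a.bucket (f (e.1, e.1)) = c} : ℝ) ≤
      τ * (18 * (m / q ^ 2) * q) ∧
    ∀ y ∈ frequentValues q m I j,
      (#{e ∈ {e ∈ cubeTuples a.θ (allReports a.t I owner) I j | side true e = y} |
        a.bucket (f (e.1, e.1)) = c} : ℝ) ≤ τ * (18 * (m / q ^ 2))

theorem rare_not_rowBalanced (τ : ℝ) (j : Fin 3) (c : Fin q) :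
    Rare ((1 + q ^ 2) * Real.exp (2 - τ)) fun ω : Hashes p n =>
      ¬ RowBalanced a m I owner τ j c (ω j) := by
  have h := (rare_row ha hI owner τ j c).or (Rare.exists_mem (s := frequentValues q m I j)
    fun y _ => rare_cell_column ha (I := I) owner τ j c y)
  refine h.mono (fun ω hω => ?_) ?_
  · by_contra! h'
    exact hω ⟨h'.1, fun y hy => h'.2 y hy⟩
  · have h2 : (#(frequentValues q m I j) : ℝ) ≤ q ^ 2 := by
      exact_mod_cast card_frequentValues_le ha hI j
    rw [add_mul, one_mul]
    gcongr

-- Joining `RowBalanced` to the event replaces conditioning: the row is fixed by hash `j`, and only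
-- the independent hash `j + 1` is resampled.
omit hI in
theorem rare_cell (hτ : 1 ≤ τ) (j : Fin 3) (c c' : Fin q) :
    Rare (Real.exp (2 - τ)) fun ω : Hashes p n => RowBalanced a m I owner τ j c (ω j) ∧
      τ * (36 * τ * (m / q ^ 2)) < #{e ∈ {e ∈ cubeTuples a.θ (allReports a.t I owner) I j |
        a.bucket (ω j (e.1, e.1)) = c} | a.bucket (ω (j + 1) (e.2, e.2)) = c'} := by
  classical
  have : NeZero p := ⟨ha.p_pos.ne'⟩
  have h1 := ha.one_le_unit
  have hq := ha.one_le_q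
  have hτu : (m : ℝ) / q ^ 2 ≤ τ * (m / q ^ 2) := le_mul_of_one_le_left (by linarith) hτ
  refine Rare.of_update (j + 1) fun ω => ?_
  have hj : j ≠ j + 1 := by revert j; decide
  simp only [Function.update_self, Function.update_of_ne hj]
  by_cases hω : RowBalanced a m I owner τ j c (ω j)
  · have := rare_overload
      {e ∈ cubeTuples a.θ (allReports a.t I owner) I j | a.bucket (ω j (e.1, e.1)) = c}
      (fun e => (e.2, e.2)) ({v | a.bucket v = c'} : Finset (Fin p)) (W := 36 * τ * (m / q ^ 2)) τ
      (by positivity) (fun κ => ?_) ?_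
    · simpa [hω] using this
    · have h2 : (#{e ∈ {e ∈ cubeTuples a.θ (allReports a.t I owner) I j |
          a.bucket (ω j (e.1, e.1)) = c} | (e.2, e.2) = κ} : ℝ) ≤
          #{e ∈ {e ∈ cubeTuples a.θ (allReports a.t I owner) I j | side true e = κ.1} |
            a.bucket (ω j (e.1, e.1)) = c} := by
        refine Nat.cast_le.2 (card_le_card fun e he => ?_)
        simp only [mem_filter] at he ⊢
        exact ⟨⟨he.1.1, by rw [← he.2]; rfl⟩, he.1.2⟩
      refine h2.trans ?_
      -- Frequent values are thinned out by the row balance; the others have degree below `m / q ^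
      -- 2` anyway.
      by_cases hκ : κ.1 ∈ frequentValues q m I j
      · exact (hω.2 _ hκ).trans (by linarith)
      · simp only [frequentValues, mem_filter, mem_univ, true_and, not_le] at hκ
        refine le_trans (Nat.cast_le.2 ?_) (hκ.le.trans (by linarith))
        exact (card_filter_le _ _).trans
          (card_le_card (filter_subset_filter _ (filter_subset _ _)))
    · calc _ ≤ (#{v | a.bucket v = c'} : ℝ) * (18 * τ * (m / q ^ 2) * q) := by
            gcongr
            exact hω.1.trans_eq (by ring)
        _ ≤ 2 * (18 * τ * (m / q ^ 2)) * p := bucket_card_mul_le ha c' (by positivity)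
        _ = _ := by rw [Fintype.card_fin]; ring
  · simp only [hω, false_and]
    simp [Rare]
    positivity

/-- All random loads are small. -/
structure LoadsBalanced (a : Params p q) (m : ℕ) (I : TriangleInstance n)
    (owner : Fin 3 → Fin n × Fin n → Fin p) (τ : ℝ) (ω : Hashes p n) : Prop where
  light : ∀ j s v, (#{e ∈ lightTuples a.t I owner j s |
    ω (sideVar j s) (side s e, side s e) = v} : ℝ) ≤ τ * (12 * (m / q ^ 2))
  closing : ∀ j v, (#{e ∈ I j | ω (j + 1) (e.2, e.1) = v} : ℝ) ≤ τ * (12 * (m / q ^ 2))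
  paths : ∀ k v, (#{π ∈ heavyPaths a.θ (allReports a.t I owner) I k |
    ω k (π.1, π.2.2) = v} : ℝ) ≤ τ * (12 * (m / q ^ 2))
  cube : ∀ j c c', (#{e ∈ {e ∈ cubeTuples a.θ (allReports a.t I owner) I j |
    a.bucket (ω j (e.1, e.1)) = c} | a.bucket (ω (j + 1) (e.2, e.2)) = c'} : ℝ) ≤
      τ * (36 * τ * (m / q ^ 2))

theorem rare_not_loadsBalanced (hτ : 1 ≤ τ) :
    Rare (21 * p * Real.exp (2 - τ)) fun ω : Hashes p n => ¬ LoadsBalanced a m I owner τ ω := by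
  have hl := Rare.exists_index fun x : Fin 3 × Bool × Fin p =>
    rare_lightTuples ha hI owner τ x.1 x.2.1 x.2.2
  have hc := Rare.exists_index fun x : Fin 3 × Fin p => rare_closing ha hI τ x.1 x.2
  have hh := Rare.exists_index fun x : Fin 3 × Fin p => rare_heavyPaths ha hI owner τ x.1 x.2
  have hr := Rare.exists_index fun x : Fin 3 × Fin q =>
    rare_not_rowBalanced ha hI owner τ x.1 x.2
  have hk := Rare.exists_index fun x : Fin 3 × Fin q × Fin q =>
    rare_cell ha (I := I) owner hτ x.1 x.2.1 x.2.2
  refine ((((hl.or hc).or hh).or hr).or hk).mono (fun ω hω => ?_) ?_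
  · by_contra! h
    obtain ⟨⟨⟨⟨h1, h2⟩, h3⟩, h4⟩, h5⟩ := h
    exact hω ⟨fun j s v => h1 (j, s, v), fun j v => h2 (j, v), fun k v => h3 (k, v),
      fun j c c' => h5 (j, c, c') (h4 (j, c))⟩
  · simp only [Fintype.card_prod, Fintype.card_fin, Fintype.card_bool, Nat.cast_mul]
    push_cast
    have h1 := ha.one_le_q
    have h2 := ha.le_p'
    have h3 : (q : ℝ) ≤ q ^ 3 := le_self_pow₀ h1 (by norm_num)
    have h4 : (q : ℝ) * q ≤ q ^ 3 := by
      rw [← sq]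
      exact pow_le_pow_right₀ h1 (by norm_num)
    -- The terms count the events for light tuples, closing tuples, paths, rows and cells; `q`, `q ^
    -- 2` and `q ^ 3` are all at most `p`.
    have h5 : (3 * (2 * p) + 3 * p + 3 * p + 3 * q * (1 + q ^ 2) + 3 * (q * q) : ℝ) ≤ 21 * p := by
      nlinarith
    refine le_trans (le_of_eq ?_) (mul_le_mul_of_nonneg_right h5 (Real.exp_pos (2 - τ)).le)
    ring

end Cube

/-! ### The load of the algorithm -/

theorem sum_card_le_card {ι α : Type*} [Fintype ι] (A : ι → Finset α) (S : Finset α) (f : α → ι)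
    (h : ∀ u, ∀ e ∈ A u, e ∈ S ∧ f e = u) : ∑ u, #(A u) ≤ #S := by
  classical
  rw [card_eq_sum_card_fiberwise (f := f) (t := univ) fun _ _ => by simp]
  exact sum_le_sum fun u _ => card_le_card fun e he => by simpa using h u e he

section Load

variable {p q n : ℕ}

open Classical in
theorem card_tupleWords (E : Fin 3 → Fin n × Fin n → Prop) :
    #(tupleWords E) = ∑ j, #{e | E j e} := by
  have h : ∀ w ∈ tupleWords E, w.2.1 ∈ univ := fun _ _ => mem_univ _
  rw [card_eq_sum_card_fiberwise h]
  refine sum_congr rfl fun j _ => ?_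
  refine card_bij (fun w _ => w.2.2) ?_ ?_ ?_
  · rintro ⟨o, j', e⟩ hw
    simp only [tupleWords, mem_filter, mem_univ, true_and] at hw ⊢
    obtain ⟨⟨rfl, h⟩, rfl⟩ := hw
    exact h
  · rintro ⟨o, j', e⟩ hw ⟨o', j'', e'⟩ hw' h
    simp only [tupleWords, mem_filter, mem_univ, true_and] at hw hw' h
    obtain ⟨⟨rfl, -⟩, rfl⟩ := hw
    obtain ⟨⟨rfl, -⟩, rfl⟩ := hw'
    rw [h]
  · intro e he
    simp only [mem_filter, mem_univ, true_and] at he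
    exact ⟨(none, j, e), by simpa using he, rfl⟩

theorem sum_card_tupleWords_le (owner : Fin 3 → Fin n × Fin n → Fin p)
    (E : Fin p → Fin 3 → Fin n × Fin n → Prop) (S : Fin 3 → Finset (Fin n × Fin n))
    (h : ∀ u j e, E u j e → e ∈ S j ∧ owner j e = u) :
    ∑ u, #(tupleWords (E u)) ≤ ∑ j, #(S j) := by
  classical
  simp only [card_tupleWords]
  rw [sum_comm]
  refine sum_le_sum fun j _ => sum_card_le_card _ _ (owner j) fun u e he => h u j e ?_
  simpa using he

variable {m : ℕ} {a : Params p q} (ha : a.Fits m) {I : TriangleInstance n}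
  (hI : ∀ j, #(I j) = m) (owner : Fin 3 → Fin n × Fin n → Fin p) {τ : ℝ} {ω : Hashes p n}

theorem sum_card_routed_le (t : ℕ) (v : Fin p) :
    ∑ u, #(tupleWords (routed t ω (fragment I owner u) v)) ≤
      ∑ j, ∑ s, #{e ∈ lightTuples t I owner j s |
        ω (sideVar j s) (side s e, side s e) = v} := by
  classical
  refine (sum_card_tupleWords_le owner _ (fun j => univ.biUnion fun s =>
    {e ∈ lightTuples t I owner j s | ω (sideVar j s) (side s e, side s e) = v})
    fun u j e he => ?_).trans (sum_le_sum fun j _ => card_biUnion_le)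
  obtain ⟨he, s, hs, hv⟩ := he
  rw [mem_fragment] at he
  obtain ⟨he, rfl⟩ := he
  refine ⟨mem_biUnion.2 ⟨s, mem_univ _, mem_filter.2 ⟨?_, hv⟩⟩, rfl⟩
  simp only [lightTuples, mem_filter]
  exact ⟨he, hs⟩

/-- A path is sent only by the hash of its middle value, so it is counted for one sender and costs
two tuples. -/
theorem sum_card_pathTuple_le (θ : ℕ) (R : Fin p → Finset (Word n))
    (K : Fin p → TriangleInstance n) (hK : ∀ u j e, e ∈ K u j → e ∈ I j) (v : Fin p) :
    ∑ u, #(tupleWords (PathTuple θ R ω (K u) u v)) ≤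
      ∑ k, 2 * #{π ∈ heavyPaths θ R I k | ω k (π.1, π.2.2) = v} := by
  classical
  let A : Fin p → Fin 3 → Finset (Fin n × Fin n × Fin n) := fun u k =>
    {π ∈ heavyPaths θ R I k | ω k (π.1, π.2.2) = v ∧ ω (k + 1) (π.2.1, π.2.1) = u}
  calc ∑ u, #(tupleWords (PathTuple θ R ω (K u) u v))
      ≤ ∑ u, ∑ k, 2 * #(A u k) := by
        refine sum_le_sum fun u _ => ?_
        have hsub : tupleWords (PathTuple θ R ω (K u) u v) ⊆ univ.biUnion fun k =>
            (A u k).image (fun π => ((none, k, π.1, π.2.1) : Word n)) ∪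
              (A u k).image fun π => ((none, k + 1, π.2.1, π.2.2) : Word n) := by
          rintro ⟨o, j, e⟩ hw
          simp only [tupleWords, mem_filter, mem_univ, true_and] at hw
          obtain ⟨rfl, k, x, y, z, ⟨h1, h2, h3, h4, h5⟩, hu, hv, h⟩ := hw
          have hA : (x, y, z) ∈ A u k := by
            simp only [A, mem_filter, heavyPaths, mem_univ, true_and]
            exact ⟨⟨h1, hK _ _ _ h2, hK _ _ _ h3, h4, h5⟩, hv, hu⟩
          rw [mem_biUnion]
          refine ⟨k, mem_univ _, ?_⟩
          rw [mem_union, mem_image, mem_image]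
          rcases h with ⟨rfl, rfl⟩ | ⟨rfl, rfl⟩
          · exact Or.inl ⟨_, hA, rfl⟩
          · exact Or.inr ⟨_, hA, rfl⟩
        refine (card_le_card hsub).trans (card_biUnion_le.trans (sum_le_sum fun k _ => ?_))
        rw [two_mul]
        exact (card_union_le _ _).trans (add_le_add card_image_le card_image_le)
    _ ≤ _ := by
        rw [sum_comm]
        refine sum_le_sum fun k _ => ?_
        rw [← mul_sum]
        refine Nat.mul_le_mul_left _ (sum_card_le_card _ _
          (fun π => ω (k + 1) (π.2.1, π.2.1)) fun u π hπ => ?_)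
        simp only [A, mem_filter] at hπ ⊢
        tauto

open Classical in
/-- The tuples of the relation `j` that are broadcast because of the heavy value on side `s`. -/
noncomputable def broadcastTuples (θ : ℕ) (R : Fin p → Finset (Word n)) (I : TriangleInstance n)
    (j : Fin 3) (s : Bool) : Finset (Fin n × Fin n) :=
  {e ∈ I j | Heavy θ R (sideVar j s) (side s e) ∧ Reported R (sideVar j !s) (side (!s) e)}

include ha

/-- Such a tuple is a pair of a heavy and a reported value: at most `12 * q` times `12 * q ^ 5`
choices. -/
theorem card_broadcastTuples_le (hI : ∀ j, #(I j) = m) (j : Fin 3) (s : Bool) :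
    (#(broadcastTuples a.θ (allReports a.t I owner) I j s) : ℝ) ≤ 144 * (m / q ^ 2) := by
  classical
  have h : #(broadcastTuples a.θ (allReports a.t I owner) I j s) ≤ 12 * q * (12 * q ^ 5) := by
    calc _ ≤ #(heavyValues a.θ (allReports a.t I owner) (sideVar j s) ×ˢ
            reportedValues (allReports a.t I owner) (sideVar j !s)) := by
          refine card_le_card_of_injOn (fun e => (side s e, side (!s) e)) (fun e he => ?_)
            fun e _ e' _ h => ?_
          · simp only [coe_filter, broadcastTuples, Set.mem_ofPred_eq] at he
            simp only [coe_product, Set.mem_prod, mem_coe, heavyValues, reportedValues,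
              mem_filter, mem_univ, true_and]
            exact he.2
          · simp only [Prod.mk.injEq] at h
            exact eq_of_side_eq_of_side_not_eq h.1 h.2
      _ ≤ _ := by
          rw [card_product]
          exact Nat.mul_le_mul (ha.card_heavyValues_le hI owner _)
            (ha.card_reportedValues_le hI owner _)
  have h2 : (#(broadcastTuples a.θ (allReports a.t I owner) I j s) : ℝ) ≤ 144 * q ^ 6 := by
    have : 12 * q * (12 * q ^ 5) = 144 * q ^ 6 := by ring
    rw [this] at h
    exact_mod_cast h
  exact h2.trans (by gcongr; exact ha.pow_six_le)

omit ha in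
theorem sum_card_owned_le (v : Fin p) :
    ∑ u, #(tupleWords fun j e =>
        Broadcast a.θ (allReports a.t I owner) (fragment I owner u) j e ∨
        InCube a (allReports a.t I owner) ω (fragment I owner u) v j e ∨
        Closing ω (fragment I owner u) v j e) ≤
      ∑ j, (∑ s, #(broadcastTuples a.θ (allReports a.t I owner) I j s) +
        #{e ∈ {e ∈ cubeTuples a.θ (allReports a.t I owner) I j |
          a.bucket (ω j (e.1, e.1)) = a.cell v j} |
          a.bucket (ω (j + 1) (e.2, e.2)) = a.cell v (j + 1)} +
        #{e ∈ I j | ω (j + 1) (e.2, e.1) = v}) := by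
  classical
  refine (sum_card_tupleWords_le owner _ (fun j =>
    (univ.biUnion fun s => broadcastTuples a.θ (allReports a.t I owner) I j s) ∪
      {e ∈ {e ∈ cubeTuples a.θ (allReports a.t I owner) I j |
          a.bucket (ω j (e.1, e.1)) = a.cell v j} |
          a.bucket (ω (j + 1) (e.2, e.2)) = a.cell v (j + 1)} ∪
      {e ∈ I j | ω (j + 1) (e.2, e.1) = v}) fun u j e he => ?_).trans
      (sum_le_sum fun j _ => (card_union_le _ _).trans (Nat.add_le_add_right
        ((card_union_le _ _).trans (Nat.add_le_add_right card_biUnion_le _)) _))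
  rcases he with he | he | he <;> (
    have h := he.1
    rw [mem_fragment] at h
    obtain ⟨hI, rfl⟩ := h
    refine ⟨?_, rfl⟩
    rw [mem_union, mem_union])
  · obtain ⟨-, s, hs⟩ := he
    refine Or.inl (Or.inl (mem_biUnion.2 ⟨s, mem_univ _, ?_⟩))
    simp only [broadcastTuples, mem_filter]
    exact ⟨hI, hs⟩
  · refine Or.inl (Or.inr ?_)
    simp only [cubeTuples, mem_filter]
    exact ⟨⟨⟨hI, fun s => (he.2 s).1⟩, (he.2 false).2⟩, (he.2 true).2⟩
  · exact Or.inr (mem_filter.2 ⟨hI, he.2⟩)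

include hI

theorem sum_card_inbox₁_le (hτ : 1 ≤ τ) (hω : LoadsBalanced a m I owner τ ω) (v : Fin p) :
    ((∑ u, #((triangleAlgorithm n a).inbox₁ ω (fragment I owner) v u) : ℕ) : ℝ) ≤
      84 * τ * (m / q ^ 2) := by
  classical
  have h1 : ∑ u, #((triangleAlgorithm n a).inbox₁ ω (fragment I owner) v u) ≤
      12 * q ^ 5 + ∑ j, ∑ s, #{e ∈ lightTuples a.t I owner j s |
        ω (sideVar j s) (side s e, side s e) = v} := by
    calc _ ≤ ∑ u, (#(allReports a.t I owner u) +
            #(tupleWords (routed a.t ω (fragment I owner u) v))) :=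
          sum_le_sum fun u _ => card_union_le _ _
      _ ≤ _ := by
          rw [sum_add_distrib]
          exact add_le_add (ha.sum_card_allReports_le hI owner) (sum_card_routed_le owner _ v)
  have h2 : ∑ j, ∑ s, (#{e ∈ lightTuples a.t I owner j s |
      ω (sideVar j s) (side s e, side s e) = v} : ℝ) ≤ 72 * τ * (m / q ^ 2) := by
    calc _ ≤ ∑ _j : Fin 3, ∑ _s : Bool, τ * (12 * ((m : ℝ) / q ^ 2)) :=
          sum_le_sum fun j _ => sum_le_sum fun s _ => hω.light j s v
      _ = _ := by simp; ring
  have h3 : (q : ℝ) ^ 5 ≤ m / q ^ 2 :=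
    (pow_le_pow_right₀ ha.one_le_q (by norm_num)).trans ha.pow_six_le
  have h4 : (m : ℝ) / q ^ 2 ≤ τ * (m / q ^ 2) :=
    le_mul_of_one_le_left (by linarith [ha.one_le_unit]) hτ
  refine (Nat.cast_le.2 h1).trans ?_
  push_cast
  linarith

theorem sum_card_inbox₂_le (hτ : 1 ≤ τ) (hω : LoadsBalanced a m I owner τ ω) (v : Fin p) :
    ((∑ u, #((triangleAlgorithm n a).inbox₂ ω (fragment I owner) v u) : ℕ) : ℝ) ≤
      1080 * τ ^ 2 * (m / q ^ 2) := by
  classical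
  set R := allReports a.t I owner with hR
  set K : Fin p → TriangleInstance n := fun u => known (fragment I owner u)
    ((triangleAlgorithm n a).inbox₁ ω (fragment I owner) u) with hK
  have hsub : ∀ u, (triangleAlgorithm n a).inbox₂ ω (fragment I owner) v u ⊆
      tupleWords (fun j e => Broadcast a.θ R (fragment I owner u) j e ∨
        InCube a R ω (fragment I owner u) v j e ∨ Closing ω (fragment I owner u) v j e) ∪
      tupleWords (PathTuple a.θ R ω (K u) u v) := by
    rintro u ⟨o, j, e⟩ hw
    have ho : o = none := by
      have := hw
      simp only [TwoRound.inbox₂, triangleAlgorithm, tupleWords, mem_filter] at this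
      exact this.2.1
    subst ho
    rw [none_mem_inbox₂] at hw
    rw [mem_union, none_mem_tupleWords, none_mem_tupleWords]
    tauto
  have h1 : ∑ u, #((triangleAlgorithm n a).inbox₂ ω (fragment I owner) v u) ≤ _ :=
    (sum_le_sum fun u _ => (card_le_card (hsub u)).trans (card_union_le _ _)).trans
      (sum_add_distrib.trans_le (add_le_add (sum_card_owned_le owner v)
        (sum_card_pathTuple_le a.θ R K (fun u j e he => known₁_subset he) v)))
  have h2 := Nat.cast_le (α := ℝ).2 h1
  refine h2.trans ?_
  push_cast
  have h3 : (m : ℝ) / q ^ 2 ≤ τ ^ 2 * (m / q ^ 2) :=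
    le_mul_of_one_le_left (by linarith [ha.one_le_unit]) (one_le_pow₀ hτ)
  have h4 : τ * ((m : ℝ) / q ^ 2) ≤ τ ^ 2 * (m / q ^ 2) := by
    gcongr
    exact le_self_pow₀ hτ (by norm_num)
  -- `336 = 2 * 144 + 36 + 12` for broadcast, cube and closing tuples; with `24` for paths, `3 *
  -- (336 + 24) = 1080`.
  have hj : ∀ j ∈ (univ : Finset (Fin 3)),
      (∑ s, (#(broadcastTuples a.θ (allReports a.t I owner) I j s) : ℝ) +
        #{e ∈ {e ∈ cubeTuples a.θ (allReports a.t I owner) I j |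
          a.bucket (ω j (e.1, e.1)) = a.cell v j} |
          a.bucket (ω (j + 1) (e.2, e.2)) = a.cell v (j + 1)} +
        #{e ∈ I j | ω (j + 1) (e.2, e.1) = v}) ≤ 336 * τ ^ 2 * ((m : ℝ) / q ^ 2) := by
    intro j _
    have b1 := card_broadcastTuples_le ha owner hI j true
    have b2 := card_broadcastTuples_le ha owner hI j false
    have b3 := hω.cube j (a.cell v j) (a.cell v (j + 1))
    have b4 := hω.closing j v
    rw [Fintype.sum_bool]
    linarith
  have hk : ∀ k ∈ (univ : Finset (Fin 3)),
      (2 * #{π ∈ heavyPaths a.θ R I k | ω k (π.1, π.2.2) = v} : ℝ) ≤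
        24 * τ ^ 2 * ((m : ℝ) / q ^ 2) := by
    intro k _
    have := hω.paths k v
    linarith
  have s1 := sum_le_sum hj
  have s2 := sum_le_sum hk
  simp only [sum_const, card_univ, Fintype.card_fin, nsmul_eq_mul] at s1 s2
  push_cast at s1 s2
  linarith

end Load

/-! ### The choice of the parameters -/

theorem exists_cube_root {p : ℕ} (hp : 1 ≤ p) : ∃ q, 0 < q ∧ q ^ 3 ≤ p ∧ p ≤ 8 * q ^ 3 := by
  have h1 : Nat.findGreatest (fun q => q ^ 3 ≤ p) p ^ 3 ≤ p :=
    Nat.findGreatest_spec (P := fun q => q ^ 3 ≤ p) (m := 1) hp (by simpa using hp)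
  have h2 : 1 ≤ Nat.findGreatest (fun q => q ^ 3 ≤ p) p :=
    Nat.le_findGreatest hp (by simpa using hp)
  refine ⟨_, h2, h1, ?_⟩
  set q := Nat.findGreatest (fun q => q ^ 3 ≤ p) p with hq
  rcases lt_or_ge p (q + 1) with h | h
  · have : q ≤ q ^ 3 := Nat.le_self_pow (by norm_num) q
    omega
  · have h3 : ¬ (q + 1) ^ 3 ≤ p :=
      Nat.findGreatest_is_greatest (P := fun q => q ^ 3 ≤ p) (Nat.lt_succ_self q) h
    have h4 : (q + 1) ^ 3 ≤ (2 * q) ^ 3 := Nat.pow_le_pow_left (by omega) 3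
    rw [mul_pow] at h4
    omega

theorem exists_bucket {p q : ℕ} (hq : 0 < q) (hqp : q ≤ p) :
    ∃ b : Fin p → Fin q, ∀ i, #{v | b v = i} * q ≤ 2 * p := by
  refine ⟨fun v => ⟨v % q, Nat.mod_lt _ hq⟩, fun i => ?_⟩
  have h : #{v : Fin p | (⟨v % q, Nat.mod_lt _ hq⟩ : Fin q) = i} ≤ p / q + 1 := by
    refine le_of_le_of_eq (card_le_card_of_injOn (t := range (p / q + 1)) (fun v => (v : ℕ) / q)
      (fun v _ => ?_) fun v hv v' hv' h => ?_) (card_range _)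
    · simp only [coe_range, Set.mem_Iio]
      exact Nat.lt_succ_of_le (Nat.div_le_div_right v.2.le)
    · simp only [coe_filter, mem_univ, true_and, Set.mem_ofPred_eq] at hv hv'
      have h3 := congrArg Fin.val (hv.trans hv'.symm)
      simp only at h h3
      exact Fin.ext (by rw [← Nat.div_add_mod (v : ℕ) q, h, h3, Nat.div_add_mod])
  calc _ ≤ (p / q + 1) * q := Nat.mul_le_mul_right _ h
    _ ≤ 2 * p := by
      have := Nat.div_mul_le_self p q
      linarith

theorem exists_cell {p q : ℕ} (hq : 0 < q) (hqp : q ^ 3 ≤ p) :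
    ∃ f : Fin p → Fin 3 → Fin q, Function.Surjective f := by
  have : Nonempty (Fin q) := ⟨⟨0, hq⟩⟩
  obtain ⟨g⟩ : Nonempty ((Fin 3 → Fin q) ↪ Fin p) :=
    Function.Embedding.nonempty_of_card_le (by simpa using hqp)
  exact ⟨_, Function.invFun_surjective g.injective⟩

theorem exists_fits {p m : ℕ} (hp : 1 ≤ p) (hm : ∀ q : ℕ, q ^ 3 ≤ p → q ^ 8 ≤ m) :
    ∃ (q : ℕ) (a : Params p q), a.Fits m := by
  obtain ⟨q, hq, h1, h2⟩ := exists_cube_root hp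
  obtain ⟨b, hb⟩ := exists_bucket hq ((Nat.le_self_pow (by norm_num) q).trans h1)
  obtain ⟨f, hf⟩ := exists_cell hq h1
  exact ⟨q, ⟨m / q ^ 5, q ^ 4, b, f⟩, hq, h1, h2, hm q h1, rfl, rfl, hb, hf⟩

theorem Real.pow_three_rpow_two_thirds {x : ℝ} (hx : 0 ≤ x) :
    (x ^ 3) ^ ((2 : ℝ) / 3) = x ^ 2 := by
  rw [← Real.rpow_natCast x 3, ← Real.rpow_mul hx, ← Real.rpow_natCast x 2]
  norm_num

/-- The hypothesis says `p ^ (8/3) ≤ m`, and `q ≤ p ^ (1/3)`. -/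
theorem pow_eight_le {p m q : ℕ} (hp : 1 ≤ p)
    (h : (p : ℝ) ^ 2 ≤ (m : ℝ) / (p : ℝ) ^ ((2 : ℝ) / 3)) (hq : q ^ 3 ≤ p) : q ^ 8 ≤ m := by
  have hp' : (0 : ℝ) < p := by exact_mod_cast hp
  have hq' : (q : ℝ) ^ 3 ≤ p := by exact_mod_cast hq
  rw [le_div_iff₀ (by positivity)] at h
  have h1 : (q : ℝ) ^ 2 ≤ (p : ℝ) ^ ((2 : ℝ) / 3) := by
    rw [← Real.pow_three_rpow_two_thirds q.cast_nonneg]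
    exact Real.rpow_le_rpow (by positivity) hq' (by norm_num)
  have h2 : ((q : ℝ) ^ 3) ^ 2 ≤ (p : ℝ) ^ 2 := pow_le_pow_left₀ (by positivity) hq' 2
  have h3 : (q : ℝ) ^ 8 ≤ m := by
    calc (q : ℝ) ^ 8 = (q ^ 3) ^ 2 * q ^ 2 := by ring
      _ ≤ _ := mul_le_mul h2 h1 (by positivity) (by positivity)
      _ ≤ m := h
  exact_mod_cast h3

theorem Params.Fits.unit_le {p q m : ℕ} {a : Params p q} (ha : a.Fits m) :
    (m : ℝ) / q ^ 2 ≤ 4 * (m / (p : ℝ) ^ ((2 : ℝ) / 3)) := by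
  have hp : (0 : ℝ) < p := by exact_mod_cast ha.p_pos
  have hq := ha.q_pos'
  have h : (p : ℝ) ^ ((2 : ℝ) / 3) ≤ 4 * q ^ 2 := by
    calc (p : ℝ) ^ ((2 : ℝ) / 3) ≤ ((2 * q : ℝ) ^ 3) ^ ((2 : ℝ) / 3) := by
          refine Real.rpow_le_rpow hp.le (ha.p_le'.trans_eq ?_) (by norm_num)
          ring
      _ = 4 * q ^ 2 := by
          rw [Real.pow_three_rpow_two_thirds (by positivity)]
          ring
  rw [← mul_div_assoc, div_le_div_iff₀ (by positivity) (by positivity)]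
  nlinarith [m.cast_nonneg (α := ℝ), mul_le_mul_of_nonneg_left h (m.cast_nonneg (α := ℝ))]

theorem card_word_le (n : ℕ) : Fintype.card (Word n) ≤ 2 ^ (2 * Nat.clog 2 n + 4) := by
  have h := Nat.le_pow_clog (b := 2) (by norm_num) n
  have h2 := Nat.mul_le_mul h h
  have h3 : Fintype.card (Word n) = 9 * (n * n) := by
    simp [Word]
    ring
  rw [h3, pow_add, mul_comm 2, pow_mul, sq]
  linarith

theorem word_length_le {n : ℕ} (hn : 2 ≤ n) :
    ((2 * Nat.clog 2 n + 4 : ℕ) : ℝ) ≤ 8 * Real.logb 2 n := by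
  have hn' : (2 : ℝ) ≤ n := by exact_mod_cast hn
  have h1 : 1 ≤ Real.logb 2 n := by
    rw [Real.le_logb_iff_rpow_le (by norm_num) (by linarith)]
    simpa using hn'
  have h2 := (Nat.ceil_lt_add_one (zero_le_one.trans h1)).le
  rw [show ((2 : ℝ)) = ((2 : ℕ) : ℝ) by norm_num, Real.natCeil_logb_natCast] at h2
  push_cast at h2 ⊢
  linarith

/-- The exponent is at most `-4 - (c + 1) * log p`: `exp 4` absorbs the `21`, and the extra power of
`p` absorbs the number of events. -/
theorem failure_probability_le {p : ℕ} (hp : 1 ≤ p) (c : ℕ) :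
    21 * p * Real.exp (2 - (c + 6) * (1 + Real.log p)) ≤ 1 / (p : ℝ) ^ c := by
  have hp' : (1 : ℝ) ≤ p := by exact_mod_cast hp
  have hlog := Real.log_nonneg hp'
  have h4 : 21 ≤ Real.exp 4 := by
    have h := Real.exp_one_gt_d9.le
    have h2 : Real.exp 4 = Real.exp 1 ^ 4 := by
      rw [← Real.exp_nat_mul]
      norm_num
    rw [h2]
    exact le_trans (by norm_num) (pow_le_pow_left₀ (by norm_num) h 4)
  have h5 : Real.exp (2 - (c + 6) * (1 + Real.log p)) ≤
      Real.exp (-4 - ((c + 1 : ℕ) : ℝ) * Real.log p) := by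
    rw [Real.exp_le_exp]
    push_cast
    nlinarith [c.cast_nonneg (α := ℝ)]
  rw [sub_eq_add_neg (-4 : ℝ), Real.exp_add, Real.exp_neg, Real.exp_neg, Real.exp_nat_mul,
    Real.exp_log (by linarith), ← mul_inv] at h5
  rw [le_div_iff₀ (by positivity)]
  calc 21 * p * Real.exp (2 - (c + 6) * (1 + Real.log p)) * p ^ c
      ≤ 21 * p * (Real.exp 4 * p ^ (c + 1))⁻¹ * p ^ c := by gcongr
    _ = 21 / Real.exp 4 := by
        rw [pow_succ]
        have := Real.exp_pos 4
        field_simp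
    _ ≤ 1 := (div_le_one (Real.exp_pos 4)).2 h4

/-! ### The theorem -/

/-- For each size of the input there is an algorithm with constants that do not depend on the
size. -/
theorem exists_triangle_mpc (p n m : ℕ) :
    ∃ A : MPCAlgorithm p (TriangleInstance n) (Fin n × Fin n × Fin n), A.rounds = 2 ∧
      ∀ c : ℕ, 1 ≤ p → (p : ℝ) ^ 2 ≤ (m : ℝ) / (p : ℝ) ^ ((2 : ℝ) / 3) →
        ∀ I : TriangleInstance n, (∀ j, #(I j) = m) →
        ∀ owner : Fin 3 → Fin n × Fin n → Fin p,
          (∀ ω : A.Coins, A.result ω (fragment I owner) = triangleQuery I) ∧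
          (1 - 1 / (p : ℝ) ^ c) * (Fintype.card A.Coins : ℝ) ≤
            (Nat.card {ω : A.Coins // (A.load ω (fragment I owner) : ℝ) ≤
              17280 * (c + 6) ^ 2 * (1 + Real.log p) ^ 2 *
                (bitSize m n / (p : ℝ) ^ ((2 : ℝ) / 3))} : ℝ) := by
  by_cases h : 1 ≤ p ∧ (p : ℝ) ^ 2 ≤ (m : ℝ) / (p : ℝ) ^ ((2 : ℝ) / 3)
  swap
  -- Outside the admissible range nothing is claimed beyond the two rounds, so a silent algorithm
  -- serves.
  · exact ⟨⟨Unit, 2, fun _ _ _ _ _ => [], fun _ _ _ _ => ∅⟩, rfl,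
      fun c h1 h2 => absurd ⟨h1, h2⟩ h⟩
  obtain ⟨hp, hpm⟩ := h
  obtain ⟨q, a, ha⟩ := exists_fits hp fun q => pow_eight_le hp hpm
  obtain ⟨enc, dec, hdec, hlen⟩ := exists_finset_encoding (Nat.succ_pos _) (card_word_le n)
  have : Nonempty (Hashes p n) := ⟨fun _ _ => ⟨0, ha.p_pos⟩⟩
  refine ⟨(triangleAlgorithm n a).toMPC enc dec, rfl, fun c _ _ I hI owner => ⟨fun ω => ?_, ?_⟩⟩
  · exact (TwoRound.result_toMPC _ hdec ω _).trans (biUnion_final_eq_triangleQuery ha.cell)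
  -- For `p = 1` the required probability is `0`.
  rcases hp.eq_or_lt with rfl | hp2
  · simp
  have hp' : (1 : ℝ) ≤ p := by exact_mod_cast hp
  set τ : ℝ := (c + 6) * (1 + Real.log p) with hτ
  have hτ1 : 1 ≤ τ := by
    have := Real.log_nonneg hp'
    nlinarith [c.cast_nonneg (α := ℝ)]
  -- For `n ≤ 1` a word would still cost bits while `bitSize` vanishes; but then `m ≤ 1`,
  -- contradicting `4 ≤ p ^ 2`.
  have hn : 2 ≤ n := by
    by_contra! hn
    have h1 : m ≤ 1 := by
      rw [← hI 0]
      refine (card_le_univ _).trans ?_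
      simp only [Fintype.card_prod, Fintype.card_fin]
      interval_cases n <;> simp
    have h2 : (1 : ℝ) ≤ (p : ℝ) ^ ((2 : ℝ) / 3) := Real.one_le_rpow hp' (by norm_num)
    have h3 : (m : ℝ) ≤ 1 := by exact_mod_cast h1
    have h4 : (m : ℝ) / (p : ℝ) ^ ((2 : ℝ) / 3) ≤ 1 := (div_le_one (by linarith)).2 (h3.trans h2)
    have h5 : (2 : ℝ) ≤ p := by exact_mod_cast hp2
    nlinarith
  have hrare := (rare_not_loadsBalanced ha hI owner hτ1).mono (fun _ h => h)
    (failure_probability_le hp c)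
  refine hrare.le_card_compl fun ω hω => ?_
  rw [not_not] at hω
  have hlogn : 0 ≤ 8 * Real.logb 2 n := le_trans (Nat.cast_nonneg _) (word_length_le hn)
  have hb : ∀ x : ℝ, x ≤ 1080 * τ ^ 2 * (m / q ^ 2) → 0 ≤ x →
      ((2 * Nat.clog 2 n + 4 : ℕ) : ℝ) * x ≤ 17280 * (c + 6) ^ 2 * (1 + Real.log p) ^ 2 *
                (bitSize m n / (p : ℝ) ^ ((2 : ℝ) / 3)) := by
    intro x hx hx0
    -- `8 * 1080 * 4 = 2 * 17280`, where the factor `2` belongs to `bitSize`.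
    calc _ ≤ 8 * Real.logb 2 n * (1080 * τ ^ 2 * (4 * (m / (p : ℝ) ^ ((2 : ℝ) / 3)))) := by
          refine mul_le_mul (word_length_le hn) (hx.trans ?_) hx0 hlogn
          gcongr
          exact ha.unit_le
      _ = _ := by
          rw [hτ, bitSize]
          ring
  refine (triangleAlgorithm n a).load_toMPC_le hdec hlen ω _
    ((mul_nonneg (Nat.cast_nonneg _) le_rfl).trans (hb 0 (by positivity) le_rfl))
    (fun v => hb _ ?_ (Nat.cast_nonneg _)) fun v => hb _ ?_ (Nat.cast_nonneg _)
  · refine (sum_card_inbox₁_le ha hI owner hτ1 hω v).trans ?_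
    have h1 : τ ≤ τ ^ 2 := le_self_pow₀ hτ1 (by norm_num)
    have h2 := ha.one_le_unit
    gcongr
    linarith
  · exact sum_card_inbox₂_le ha hI owner hτ1 hω v

theorem mainTheorem4 :
    ∃ A : (p n m : ℕ) → MPCAlgorithm p (TriangleInstance n) (Fin n × Fin n × Fin n),
      (∀ p n m : ℕ, (A p n m).rounds = 2) ∧
      ∀ c : ℕ, ∃ (C : ℝ) (k : ℕ), ∀ p n m : ℕ, 1 ≤ p →
        (p : ℝ) ^ 2 ≤ (m : ℝ) / (p : ℝ) ^ ((2 : ℝ) / 3) →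
        ∀ I : TriangleInstance n, (∀ j, (I j).card = m) →
        ∀ owner : Fin 3 → Fin n × Fin n → Fin p, IsUniformPartition I owner →
          (∀ ω : (A p n m).Coins, (A p n m).result ω (fragment I owner) = triangleQuery I) ∧
          (1 - 1 / (p : ℝ) ^ c) * (Fintype.card (A p n m).Coins : ℝ) ≤
            (Nat.card {ω : (A p n m).Coins // ((A p n m).load ω (fragment I owner) : ℝ) ≤
              C * (1 + Real.log p) ^ k * (bitSize m n / (p : ℝ) ^ ((2 : ℝ) / 3))} : ℝ) := by
  choose A hA using exists_triangle_mpc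
  exact ⟨A, fun p n m => (hA p n m).1, fun c => ⟨17280 * (c + 6) ^ 2, 2,
    fun p n m hp hpm I hI owner _ => (hA p n m).2 c hp hpm I hI owner⟩⟩
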